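/- Let $A$ be a finite alphabet. A \emph{substitution} on $A$ is a morphism $\sigma : A \to A^*$ such that $\lim_{n\to\infty} |\sigma^n(a)| = +\infty$ for every letter $a \in A$; its matrix is $M_\sigma = (m_{i,j})_{i,j\in A}$, where $m_{i,j}$ is the number of occurrences of $i$ in $\sigma(j)$, and its \emph{dominant eigenvalue} is the real eigenvalue of $M_\sigma$ that is greater than or equal to the modulus of every complex eigenvalue of $M_\sigma$. A sequence $x = x_0x_1x_2\cdots \in A^{\mathbb N}$ is a \emph{fixed point} of $\sigma$ if $\sigma(x_0)\sigma(x_1)\sigma(x_2)\cdots = x$, and a \emph{proper fixed point} if moreover every letter of $A$ occurs in $x$. Let $x \in A^{\mathbb N}$ be a proper fixed point of a substitution $\sigma : A \to A^*$ with dominant eigenvalue $\alpha$, and suppose that $x$ is also a (proper) fixed point of a substitution $\tau : A \to A^*$ with dominant eigenvalue $\beta$. If $\alpha$ and $\beta$ are multiplicatively independent, i.e. $\alpha^k \neq \beta^l$ for all integers $k, l > 0$, then $x$ is ultimately periodic: there are a word $u$ and a non-empty word $v$ such that $x = uvvv\cdots$. -/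

import Mathlib

open Filter

/-- The morphism `A* → B*` induced by concatenation by a map `τ : A → B*`. -/
def morphWord {A B : Type*} (τ : A → List B) (w : List A) : List B :=
  w.flatMap τ

/-- The prefix `x₀ x₁ ⋯ xₙ₋₁` of length `n` of the sequence `x`. -/
def seqPrefix {A : Type*} (x : ℕ → A) (n : ℕ) : List A :=
  (List.range n).map x

/-- A substitution on `A`: a morphism `τ : A → A*` such that `|τⁿ(a)| → ∞` for every letter `a`. -/
structure WordSubstitution (A : Type*) where
  toFun : A → List A
  tendsto_length : ∀ a : A,
    Tendsto (fun n : ℕ => ((morphWord toFun)^[n] [a]).length) atTop atTop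

namespace WordSubstitution

/-- A substitution sends every letter to a non-empty word. -/
theorem toFun_ne_nil {A : Type*} (σ : WordSubstitution A) (a : A) : σ.toFun a ≠ [] := by
  intro h
  have hnil : ∀ n : ℕ, (morphWord σ.toFun)^[n] [] = [] := by
    intro n
    induction n with
    | zero => rfl
    | succ k ih => rw [Function.iterate_succ_apply]; exact ih
  obtain ⟨n, hn, h1⟩ :=
    ((eventually_ge_atTop 1).and ((σ.tendsto_length a).eventually_ge_atTop 1)).exists
  obtain ⟨k, rfl⟩ : ∃ k, n = k + 1 := ⟨n - 1, by omega⟩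
  have h2 : morphWord σ.toFun [a] = [] := by simp [morphWord, h]
  rw [Function.iterate_succ_apply, h2, hnil] at h1
  simp at h1

/-- The image of a word under a substitution is at least as long as the word. -/
theorem length_le_length_morphWord {A : Type*} (σ : WordSubstitution A) (w : List A) :
    w.length ≤ (morphWord σ.toFun w).length := by
  induction w with
  | nil => simp
  | cons a w ih =>
    have h := List.length_pos_iff.mpr (σ.toFun_ne_nil a)
    simp only [morphWord, List.flatMap_cons, List.length_append, List.length_cons] at ih ⊢
    omega

/-- The image `σ(x) = σ(x₀)σ(x₁)σ(x₂)⋯` of a sequence `x`. Its letter of index `n` is read off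
the word `σ(x₀ ⋯ xₙ)`, which is a prefix of `σ(x)` of length at least `n + 1`. -/
def mapSeq {A : Type*} (σ : WordSubstitution A) (x : ℕ → A) (n : ℕ) : A :=
  (morphWord σ.toFun (seqPrefix x (n + 1)))[n]'(by
    have h := σ.length_le_length_morphWord (seqPrefix x (n + 1))
    have h' : (seqPrefix x (n + 1)).length = n + 1 := by simp [seqPrefix]
    omega)

/-- `x` is a fixed point of `σ`: `σ(x) = x`. -/
def IsFixedPt {A : Type*} (σ : WordSubstitution A) (x : ℕ → A) : Prop :=
  σ.mapSeq x = x

/-- `x` is a proper fixed point of `σ`: a fixed point in which all letters of `A` occur. -/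
def IsProperFixedPt {A : Type*} (σ : WordSubstitution A) (x : ℕ → A) : Prop :=
  σ.IsFixedPt x ∧ ∀ a : A, ∃ n : ℕ, x n = a

end WordSubstitution

/-- The matrix of a morphism `τ : A → B*`: the entry `(i, j)` is the number of occurrences of the
letter `i` in the word `τ(j)`. -/
def morphMatrix {A B : Type*} [DecidableEq B] (τ : A → List B) : Matrix B A ℕ :=
  Matrix.of fun i j => (τ j).count i

/-- `r` is the dominant eigenvalue of the square non-negative integer matrix `M`: a real
eigenvalue that is at least the modulus of every complex eigenvalue of `M`. -/
def IsDominantEigenvalue {A : Type*} [Fintype A] [DecidableEq A] (M : Matrix A A ℕ) (r : ℝ) :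
    Prop :=
  Module.End.HasEigenvalue (Matrix.toLin' (M.map (Nat.cast : ℕ → ℂ))) (r : ℂ) ∧
    ∀ μ : ℂ, Module.End.HasEigenvalue (Matrix.toLin' (M.map (Nat.cast : ℕ → ℂ))) μ → ‖μ‖ ≤ r

/-- `r` is the dominant eigenvalue of the substitution `σ`, that is, of its matrix. -/
def WordSubstitution.HasDominantEigenvalue {A : Type*} [Fintype A] [DecidableEq A]
    (σ : WordSubstitution A) (r : ℝ) : Prop :=
  IsDominantEigenvalue (morphMatrix σ.toFun) r

/-- `αᵏ ≠ βˡ` for all integers `k, l > 0`. -/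
def MultIndependent (α β : ℝ) : Prop :=
  ∀ k l : ℕ, 0 < k → 0 < l → α ^ k ≠ β ^ l

/-- `x = u v v v ⋯` for a word `u` (of length `N`) and a non-empty word `v` (of length `p`). -/
def IsUltimatelyPeriodic {A : Type*} (x : ℕ → A) : Prop :=
  ∃ N p : ℕ, 0 < p ∧ ∀ n : ℕ, N ≤ n → x (n + p) = x n

/-! A substitution fixing `x` is encoded by the map `i ↦ |σ(x₀ ⋯ xᵢ₋₁)|`, a cut of `x`. Cuts
compose, and by Gelfand's formula the iterates of the two cuts grow with exponents `log α` and `log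
β` (`WordSubstitution.IsProperFixedPt.hasGrowthExponent`). It remains to show that two growing cuts
with rationally independent exponents force periodicity (`isUltimatelyPeriodic_of_cuts`).

Both cuts are regarded as cuts of the sequence of two-letter words and replaced by powers, so that
the set of letters of a block no longer changes under iteration. A minimal alphabet `B` over which
arbitrarily long words occur depends on the sequence alone. Both cuts send each letter of `B` to a
word over `B` that contains all of `B` (`IsIdemCut.isLeafCut`): on `B` both matrices are positive.

Independence is used twice. Suppose that the sequence leaves `B` infinitely often. The right ends of
long runs over `B` contain an orbit on which both cuts act as strictly increasing self-maps, with
boundedly many orbit points between a point and its image (`exists_countIco_runOrbit_le`). Such a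
map is eventually a shift of the enumeration of the orbit, so positive powers of the two maps agree
along an orbit and the exponents are dependent. Hence the sequence is eventually over `B`
(`eventually_mem_leaf`).

Now let `T (n, m)` be the distance between the images under `fⁿ gᵐ` of two occurrences of one
two-letter word. By Perron–Frobenius, `T` is asymptotically multiplied by a constant in each
direction (`exists_growth_rate`). Independence of these constants yields arbitrarily many distinct
values of `T` in some window `[Θ, MΘ)`. If `x` is not ultimately periodic, the number of such values
is bounded independently of `Θ` (`exists_distances_eq`): two nearly equal distances measured over
the same word give a short period of the image of a two-letter word, and positivity spreads that
period over the whole tail (`exists_no_short_period`). -/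

/-! ### Cuts of a sequence. -/

/-- The map `f` cuts the sequence `x` into the consecutive blocks `x[f i, f (i + 1))`, and the
block of index `i` depends only on the letter `x i`: the map `i ↦ |σ(x₀ ⋯ xᵢ₋₁)|` for a
substitution `σ` that fixes `x` has this property. -/
structure IsCut {A : Type*} (x : ℕ → A) (f : ℕ → ℕ) : Prop where
  zero : f 0 = 0
  lt_succ : ∀ i, f i < f (i + 1)
  len : ∀ i j, x i = x j → f (i + 1) + f j = f (j + 1) + f i
  block : ∀ i j, x i = x j → ∀ s, f i + s < f (i + 1) → x (f i + s) = x (f j + s)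

namespace IsCut

variable {A : Type*} {x : ℕ → A} {f g : ℕ → ℕ}

theorem strictMono (h : IsCut x f) : StrictMono f := strictMono_nat_of_lt_succ h.lt_succ

theorem mono (h : IsCut x f) : Monotone f := h.strictMono.monotone

theorem le_apply (h : IsCut x f) (i : ℕ) : i ≤ f i := h.strictMono.le_apply

theorem add_le (h : IsCut x f) (i d : ℕ) : f i + d ≤ f (i + d) := by
  induction d with
  | zero => simp
  | succ d ih => have := h.lt_succ (i + d); rw [← add_assoc i d 1]; omega

protected theorem id (x : ℕ → A) : IsCut x id :=
  ⟨rfl, fun i => Nat.lt_succ_self i, fun i j _ => by simp; omega, fun i j hij s hs => by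
    have : s = 0 := by simp at hs; omega
    simpa [this] using hij⟩

/-- Equal words of `x` are cut alike. -/
theorem word_len (h : IsCut x f) {i j ℓ : ℕ} (hw : ∀ s < ℓ, x (i + s) = x (j + s)) :
    f (i + ℓ) + f j = f (j + ℓ) + f i := by
  induction ℓ with
  | zero => simp; omega
  | succ ℓ ih =>
    have h1 := ih fun s hs => hw s (by omega)
    have h2 := h.len (i + ℓ) (j + ℓ) (hw ℓ (by omega))
    rw [← add_assoc i, ← add_assoc j]; omega

theorem word_block (h : IsCut x f) {i j ℓ : ℕ} (hw : ∀ s < ℓ, x (i + s) = x (j + s)) {s : ℕ}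
    (hs : f i + s < f (i + ℓ)) : x (f i + s) = x (f j + s) := by
  induction ℓ generalizing s with
  | zero => simp at hs
  | succ ℓ ih =>
    have hw' : ∀ s < ℓ, x (i + s) = x (j + s) := fun s hs => hw s (by omega)
    by_cases h1 : f i + s < f (i + ℓ)
    · exact ih hw' h1
    · have h2 := h.word_len hw'
      have h3 := h.mono (Nat.le_add_right i ℓ)
      have h4 := h.block (i + ℓ) (j + ℓ) (hw ℓ (by omega)) (f i + s - f (i + ℓ)) (by
        rw [← add_assoc i] at hs; omega)
      rw [show f (i + ℓ) + (f i + s - f (i + ℓ)) = f i + s by omega,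
        show f (j + ℓ) + (f i + s - f (i + ℓ)) = f j + s by omega] at h4
      exact h4

protected theorem comp (hg : IsCut x g) (hf : IsCut x f) : IsCut x (g ∘ f) where
  zero := by simp [hf.zero, hg.zero]
  lt_succ i := hg.strictMono (hf.lt_succ i)
  len i j hij := by
    have h1 := hf.len i j hij
    have h2 := hf.lt_succ i
    have := hg.word_len (i := f i) (j := f j) (ℓ := f (i + 1) - f i) fun s hs =>
      hf.block i j hij s (by omega)
    rwa [show f i + (f (i + 1) - f i) = f (i + 1) by omega,
      show f j + (f (i + 1) - f i) = f (j + 1) by omega] at this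
  block i j hij s hs := by
    have h2 := hf.lt_succ i
    refine hg.word_block (i := f i) (j := f j) (ℓ := f (i + 1) - f i) (fun s hs =>
      hf.block i j hij s (by omega)) ?_
    rwa [show f i + (f (i + 1) - f i) = f (i + 1) by omega]

protected theorem iterate (hf : IsCut x f) (n : ℕ) : IsCut x f^[n] := by
  induction n with
  | zero => exact IsCut.id x
  | succ n ih => rw [Function.iterate_succ]; exact ih.comp hf

/-- A cut of `x` is a cut of the sequence of the words of length two of `x`. -/
theorem pair (hf : IsCut x f) : IsCut (fun i => (x i, x (i + 1))) f where
  zero := hf.zero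
  lt_succ := hf.lt_succ
  len i j hij := hf.len i j (Prod.ext_iff.1 hij).1
  block i j hij s hs := by
    obtain ⟨h0, h1⟩ := Prod.ext_iff.1 hij
    have hw : ∀ s < 2, x (i + s) = x (j + s) := by
      intro s hs
      interval_cases s
      · exact h0
      · exact h1
    have h2 := hf.lt_succ (i + 1)
    refine Prod.ext (hf.block i j h0 s hs) ?_
    have := hf.word_block hw (s := s + 1) (by rw [show i + 2 = i + 1 + 1 by rfl]; omega)
    simpa only [add_assoc] using this

/-- Every position lies in a block. -/
theorem exists_block (hf : IsCut x f) (s : ℕ) : ∃ k, f k ≤ s ∧ s < f (k + 1) := by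
  have hex : ∃ k, s < f (k + 1) := ⟨s, by have := hf.le_apply (s + 1); omega⟩
  refine ⟨Nat.find hex, ?_, Nat.find_spec hex⟩
  rcases h : Nat.find hex with _ | k
  · simp [hf.zero]
  · exact not_lt.1 (Nat.find_min hex (m := k) (by omega))

theorem exists_bound [Finite A] (hf : IsCut x f) : ∃ M, 1 ≤ M ∧ ∀ i, f (i + 1) ≤ f i + M := by
  classical
  have : ∀ a : A, ∃ M, ∀ i, x i = a → f (i + 1) ≤ f i + M := by
    intro a
    by_cases ha : ∃ j, x j = a
    · obtain ⟨j, rfl⟩ := ha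
      exact ⟨f (j + 1), fun i hi => by have := hf.len i j hi; omega⟩
    · exact ⟨0, fun i hi => absurd ⟨i, hi⟩ ha⟩
  choose M hM using this
  have := Fintype.ofFinite A
  refine ⟨1 + ∑ a, M a, by omega, fun i => ?_⟩
  have h1 := hM (x i) i rfl
  have h2 := Finset.single_le_sum (f := M) (fun a _ => Nat.zero_le _) (Finset.mem_univ (x i))
  omega

/-- If all `G`-blocks in `[i, j)` are at most `D` long, then so is `[G i, G j)` up to the
factor `j - i`. -/
theorem sub_le_mul {G : ℕ → ℕ} {i j D : ℕ} (h : ∀ k, i ≤ k → k < j → G (k + 1) ≤ G k + D)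
    (hij : i ≤ j) : G j ≤ G i + (j - i) * D := by
  induction j, hij using Nat.le_induction with
  | base => simp
  | succ j hij ih =>
    have h1 := ih fun k hk hk' => h k hk (by omega)
    have h2 := h j hij (by omega)
    rw [show j + 1 - i = (j - i) + 1 by omega, add_mul]; omega

theorem mul_le_sub {G : ℕ → ℕ} {i j D : ℕ} (h : ∀ k, i ≤ k → k < j → G k + D ≤ G (k + 1))
    (hij : i ≤ j) : G i + (j - i) * D ≤ G j := by
  induction j, hij using Nat.le_induction with
  | base => simp
  | succ j hij ih =>
    have h1 := ih fun k hk hk' => h k hk (by omega)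
    have h2 := h j hij (by omega)
    rw [show j + 1 - i = (j - i) + 1 by omega, add_mul]; omega

end IsCut

/-! ### Letter sets of blocks and idempotent powers. -/

/-- The letters of the block of index `i`. -/
def cutLetters {A : Type*} (x : ℕ → A) (f : ℕ → ℕ) (i : ℕ) : Set A :=
  x '' Set.Ico (f i) (f (i + 1))

/-- The cut `f` does not change the set of letters of a block when iterated, and its blocks have
length at least two. -/
structure IsIdemCut {A : Type*} (x : ℕ → A) (f : ℕ → ℕ) : Prop extends IsCut x f where
  two_le : ∀ i, f i + 2 ≤ f (i + 1)
  idem : ∀ i, cutLetters x (f ∘ f) i = cutLetters x f i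

section Letters

variable {A : Type*} {x : ℕ → A} {f g : ℕ → ℕ}

theorem cutLetters_congr (hf : IsCut x f) {i j : ℕ} (hij : x i = x j) :
    cutLetters x f i = cutLetters x f j := by
  have key : ∀ i j, x i = x j → cutLetters x f i ⊆ cutLetters x f j := by
    rintro i j hij _ ⟨s, ⟨h1, h2⟩, rfl⟩
    have h3 := hf.len i j hij
    refine ⟨f j + (s - f i), ⟨by omega, by omega⟩, ?_⟩
    have := hf.block i j hij (s - f i) (by omega)
    rw [← this, show f i + (s - f i) = s by omega]
  exact (key i j hij).antisymm (key j i hij.symm)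

theorem mem_cutLetters_comp (hg : IsCut x g) {i : ℕ} {a : A} :
    a ∈ cutLetters x (g ∘ f) i ↔ ∃ k ∈ Set.Ico (f i) (f (i + 1)), a ∈ cutLetters x g k := by
  constructor
  · rintro ⟨s, ⟨h1, h2⟩, rfl⟩
    obtain ⟨k, hk1, hk2⟩ := hg.exists_block s
    refine ⟨k, ⟨?_, ?_⟩, s, ⟨hk1, hk2⟩, rfl⟩
    · have := hg.strictMono.lt_iff_lt.1 (lt_of_le_of_lt h1 hk2); omega
    · exact hg.strictMono.lt_iff_lt.1 (lt_of_le_of_lt hk1 h2)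
  · rintro ⟨k, ⟨h1, h2⟩, s, ⟨h3, h4⟩, rfl⟩
    refine ⟨s, ⟨(hg.mono h1).trans h3, lt_of_lt_of_le h4 (hg.mono h2)⟩, rfl⟩

/-- The letters of a composite block are determined by the letter sets of the two cuts, not by the
order or multiplicity of letters. Letter sets thus take finitely many values compatible with
composition, and an idempotent power can be found as in a finite semigroup. -/
theorem cutLetters_comp_congr {g' f' : ℕ → ℕ} (hg : IsCut x g) (hf : IsCut x f)
    (hg' : IsCut x g') (hf' : IsCut x f') (h1 : ∀ i, cutLetters x g i = cutLetters x g' i)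
    (h2 : ∀ i, cutLetters x f i = cutLetters x f' i) (i : ℕ) :
    cutLetters x (g ∘ f) i = cutLetters x (g' ∘ f') i := by
  have key : ∀ {g f g' f' : ℕ → ℕ}, IsCut x g → IsCut x f → IsCut x g' → IsCut x f' →
      (∀ i, cutLetters x g i = cutLetters x g' i) → (∀ i, cutLetters x f i = cutLetters x f' i) →
      cutLetters x (g ∘ f) i ⊆ cutLetters x (g' ∘ f') i := by
    intro g f g' f' hg hf hg' hf' h1 h2 a ha
    obtain ⟨k, hk, hak⟩ := (mem_cutLetters_comp hg).1 ha
    have h3 : x k ∈ cutLetters x f' i := h2 i ▸ ⟨k, hk, rfl⟩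
    obtain ⟨k', hk', h4⟩ := h3
    refine (mem_cutLetters_comp hg').2 ⟨k', hk', ?_⟩
    rw [← h1, cutLetters_congr hg h4]; exact hak
  exact (key hg hf hg' hf' h1 h2).antisymm
    (key hg' hf' hg hf (fun i => (h1 i).symm) fun i => (h2 i).symm)

theorem IsIdemCut.iterate_letters (h : IsIdemCut x f) {n : ℕ} (hn : 1 ≤ n) (i : ℕ) :
    cutLetters x f^[n] i = cutLetters x f i := by
  induction n, hn using Nat.le_induction generalizing i with
  | base => rfl
  | succ n hn ih =>
    rw [Function.iterate_succ, ← h.idem i]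
    exact cutLetters_comp_congr (h.toIsCut.iterate n) h.toIsCut h.toIsCut h.toIsCut ih
      (fun _ => rfl) i

theorem IsIdemCut.pow_le (h : IsIdemCut x f) (n i : ℕ) : f^[n] i + 2 ^ n ≤ f^[n] (i + 1) := by
  induction n generalizing i with
  | zero => simp
  | succ n ih =>
    rw [Function.iterate_succ, Function.comp, Function.comp, pow_succ]
    have h1 := ih (f i)
    have h2 := ih (f i + 1)
    have h3 := (h.toIsCut.iterate n).mono (h.two_le i)
    rw [show f i + 1 + 1 = f i + 2 by rfl] at h2
    omega

theorem IsIdemCut.iterate_one_ge (h : IsIdemCut x f) (n : ℕ) : 2 ^ n ≤ f^[n] 1 := by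
  have := h.pow_le n 0; simp at this; omega

theorem IsIdemCut.iterate (h : IsIdemCut x f) {n : ℕ} (hn : 1 ≤ n) : IsIdemCut x f^[n] where
  toIsCut := h.toIsCut.iterate n
  two_le i := by
    have h1 := h.pow_le n i
    have h2 : 2 ^ 1 ≤ 2 ^ n := Nat.pow_le_pow_right (by norm_num) hn
    omega
  idem i := by
    rw [← Function.iterate_add, h.iterate_letters hn, h.iterate_letters (by omega)]

/-- Every letter of `x` occurs in the first block of an idempotent cut. -/
theorem IsIdemCut.exists_lt_one (h : IsIdemCut x f) (k : ℕ) : ∃ i < f 1, x i = x k := by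
  have h1 : x k ∈ cutLetters x f^[k + 1] 0 :=
    ⟨k, ⟨by simp [(h.toIsCut.iterate _).zero], by
      have := h.iterate_one_ge (k + 1)
      have := Nat.lt_two_pow_self (n := k + 1)
      simp only [zero_add]
      omega⟩, rfl⟩
  rw [h.iterate_letters (by omega)] at h1
  obtain ⟨i, hi, hik⟩ := h1
  exact ⟨i, by simpa using hi.2, hik⟩

/-- Some power of a growing cut is idempotent. -/
theorem exists_isIdemCut_iterate [Finite A] (hf : IsCut x f)
    (hgrow : ∀ i, ∃ n, ∀ m, n ≤ m → f^[m] i + 2 ≤ f^[m] (i + 1)) :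
    ∃ p, 1 ≤ p ∧ IsIdemCut x f^[p] := by
  classical
  have hun : ∃ n0, ∀ m, n0 ≤ m → ∀ i, f^[m] i + 2 ≤ f^[m] (i + 1) := by
    have : ∀ a : A, ∃ n, ∀ m, n ≤ m → ∀ i, x i = a → f^[m] i + 2 ≤ f^[m] (i + 1) := by
      intro a
      by_cases ha : ∃ j, x j = a
      · obtain ⟨j, rfl⟩ := ha
        obtain ⟨n, hn⟩ := hgrow j
        refine ⟨n, fun m hm i hi => ?_⟩
        have h1 := (hf.iterate m).len i j hi
        have h2 := hn m hm
        omega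
      · exact ⟨0, fun m _ i hi => absurd ⟨i, hi⟩ ha⟩
    choose N hN using this
    have := Fintype.ofFinite A
    refine ⟨∑ a, N a, fun m hm i => hN (x i) m ?_ i rfl⟩
    exact (Finset.single_le_sum (f := N) (fun a _ => Nat.zero_le _) (Finset.mem_univ (x i))).trans
      hm
  obtain ⟨n0, hn0⟩ := hun
  have hpig : ∃ m k, 1 ≤ k ∧ ∀ i, cutLetters x f^[m] i = cutLetters x f^[m + k] i := by
    -- The letter sets are packed into a map from the finite alphabet, so that the pigeonhole
    -- principle applies to the iterates.
    let D : ℕ → (A → Set A) := fun n a => {b | ∃ i, x i = a ∧ b ∈ cutLetters x f^[n] i}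
    have hD : ∀ n i, D n (x i) = cutLetters x f^[n] i := by
      intro n i
      ext b
      constructor
      · rintro ⟨j, hj, hb⟩
        rwa [cutLetters_congr (hf.iterate n) hj] at hb
      · exact fun hb => ⟨i, rfl, hb⟩
    obtain ⟨m, m', hne, hmm⟩ := Finite.exists_ne_map_eq_of_infinite D
    rcases lt_or_gt_of_ne hne with h | h
    · exact ⟨m, m' - m, by omega, fun i => by
        rw [← hD, ← hD, show m + (m' - m) = m' by omega, hmm]⟩
    · exact ⟨m', m - m', by omega, fun i => by
        rw [← hD, ← hD, show m' + (m - m') = m by omega, hmm]⟩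
  obtain ⟨m, k, hk, hmk⟩ := hpig
  have step : ∀ j, ∀ i, cutLetters x f^[m + j] i = cutLetters x f^[m + k + j] i := by
    intro j i
    rw [Function.iterate_add, Function.iterate_add f (m + k)]
    exact cutLetters_comp_congr (hf.iterate _) (hf.iterate _) (hf.iterate _) (hf.iterate _) hmk
      (fun _ => rfl) i
  have hmul : ∀ t j i, cutLetters x f^[m + j] i = cutLetters x f^[m + j + t * k] i := by
    intro t
    induction t with
    | zero => simp
    | succ t ih =>
      intro j i
      rw [ih j i, show m + j + t * k = m + (j + t * k) by ring, step,
        show m + k + (j + t * k) = m + j + (t + 1) * k by ring]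
  -- The exponent is a multiple of the period `k`, at least the preperiod `m`, and at least `n0`,
  -- from which point on all blocks have length at least two. Doubling it therefore does not change
  -- the letter sets.
  refine ⟨(m + n0 + 1) * k, Nat.mul_pos (by omega) hk, hf.iterate _, hn0 _ ?_, fun i => ?_⟩
  · nlinarith
  · rw [← Function.iterate_add]
    obtain ⟨j, hj⟩ : ∃ j, (m + n0 + 1) * k = m + j := ⟨(m + n0 + 1) * k - m, by
      have : m ≤ (m + n0 + 1) * k := by nlinarith
      omega⟩
    have := hmul (m + n0 + 1) j i
    rw [← hj] at this
    exact this.symm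

end Letters

/-! ### Increasing self-maps of a set of natural numbers. -/

open scoped Classical in
/-- The number of elements of `O` in `[a, b)`. -/
noncomputable def countIco (O : Set ℕ) (a b : ℕ) : ℕ :=
  ((Finset.Ico a b).filter (· ∈ O)).card

section Count

variable {O : Set ℕ}

theorem countIco_add {a b c : ℕ} (hab : a ≤ b) (hbc : b ≤ c) :
    countIco O a b + countIco O b c = countIco O a c := by
  classical
  unfold countIco
  rw [← Finset.Ico_union_Ico_eq_Ico hab hbc, Finset.filter_union, Finset.card_union_of_disjoint]
  exact Finset.disjoint_filter_filter (Finset.Ico_disjoint_Ico_consecutive a b c)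

theorem countIco_pos {a b : ℕ} (ha : a ∈ O) (hab : a < b) : 0 < countIco O a b := by
  classical
  unfold countIco
  exact Finset.card_pos.2 ⟨a, by simp [ha, hab]⟩

theorem countIco_le_map {φ : ℕ → ℕ} (hφ : ∀ J ∈ O, φ J ∈ O)
    (hmono : ∀ J ∈ O, ∀ J' ∈ O, J < J' → φ J < φ J') {a b : ℕ} (ha : a ∈ O) (hb : b ∈ O) :
    countIco O a b ≤ countIco O (φ a) (φ b) := by
  classical
  unfold countIco
  refine Finset.card_le_card_of_injOn φ ?_ ?_
  · intro J hJ
    simp only [Finset.coe_filter, Finset.mem_Ico, Set.mem_ofPred_eq] at hJ ⊢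
    refine ⟨⟨?_, hmono J hJ.2 b hb hJ.1.2⟩, hφ J hJ.2⟩
    rcases hJ.1.1.eq_or_lt with h | h
    · rw [h]
    · exact (hmono a ha J hJ.2 h).le
  · intro J hJ J' hJ' h
    simp only [Finset.coe_filter, Finset.mem_Ico, Set.mem_ofPred_eq] at hJ hJ'
    rcases lt_trichotomy J J' with h' | h' | h'
    · exact absurd h (hmono J hJ.2 J' hJ'.2 h').ne
    · exact h'
    · exact absurd h (hmono J' hJ'.2 J hJ.2 h').ne'

theorem eq_of_countIco_eq {a b c : ℕ} (hb : b ∈ O) (hc : c ∈ O) (hab : a ≤ b) (hac : a ≤ c)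
    (h : countIco O a b = countIco O a c) : b = c := by
  rcases lt_trichotomy b c with h' | h' | h'
  · have h1 := countIco_add (O := O) hab h'.le
    have h2 := countIco_pos hb h'
    omega
  · exact h'
  · have h1 := countIco_add (O := O) hac h'.le
    have h2 := countIco_pos hc h'
    omega

/-- A strictly increasing self-map of a set `O` of natural numbers with boundedly many elements
of `O` between a point and its image is eventually a shift of the increasing enumeration. -/
theorem exists_countIco_eq {φ : ℕ → ℕ} (hO : O.Nonempty) (hφ : ∀ J ∈ O, φ J ∈ O)
    (hmono : ∀ J ∈ O, ∀ J' ∈ O, J < J' → φ J < φ J') (hlt : ∀ J ∈ O, J < φ J) {N : ℕ}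
    (hN : ∀ J ∈ O, countIco O J (φ J) ≤ N) :
    ∃ r, 1 ≤ r ∧ ∃ J₀ ∈ O, ∀ J ∈ O, J₀ ≤ J → ∀ n, countIco O J (φ^[n] J) = r * n := by
  have hinc : ∀ J ∈ O, ∀ J' ∈ O, J ≤ J' → countIco O J (φ J) ≤ countIco O J' (φ J') := by
    intro J hJ J' hJ' h
    have h0 : φ J ≤ φ J' := by
      rcases h.eq_or_lt with h | h
      · rw [h]
      · exact (hmono J hJ J' hJ' h).le
    have h1 := countIco_add (O := O) (hlt J hJ).le h0
    have h2 := countIco_add (O := O) h (hlt J' hJ').le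
    have h3 := countIco_le_map hφ hmono hJ hJ'
    omega
  have hfin : {c | ∃ J ∈ O, countIco O J (φ J) = c}.Finite :=
    (Set.finite_Iic N).subset (by rintro c ⟨J, hJ, rfl⟩; exact hN J hJ)
  obtain ⟨J1, hJ1⟩ := hO
  obtain ⟨r, ⟨J₀, hJ₀, hr⟩, hmax⟩ := hfin.exists_maximal ⟨_, J1, hJ1, rfl⟩
  have hconst : ∀ J ∈ O, J₀ ≤ J → countIco O J (φ J) = r := by
    intro J hJ h
    have h1 := hinc J₀ hJ₀ J hJ h
    rw [hr] at h1
    exact le_antisymm (hmax ⟨J, hJ, rfl⟩ h1) h1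
  refine ⟨r, ?_, J₀, hJ₀, fun J hJ h n => ?_⟩
  · rw [← hr]; exact countIco_pos hJ₀ (hlt J₀ hJ₀)
  · have : φ^[n] J ∈ O ∧ J ≤ φ^[n] J ∧ countIco O J (φ^[n] J) = r * n := by
      induction n with
      | zero => simp [hJ, countIco]
      | succ n ih =>
        obtain ⟨h1, h2, h3⟩ := ih
        rw [Function.iterate_succ_apply']
        refine ⟨hφ _ h1, h2.trans (hlt _ h1).le, ?_⟩
        rw [← countIco_add h2 (hlt _ h1).le, h3, hconst _ h1 (h.trans h2)]
        ring
    exact this.2.2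

/-- If `φ` and `ψ` are eventually the shifts by `r` and `r'`, then `φ^[r']` and `ψ^[r]` are both the
shift by `r * r'`. -/
theorem exists_iterate_eq {φ ψ : ℕ → ℕ} (hO : O.Nonempty) (hφ : ∀ J ∈ O, φ J ∈ O)
    (hφm : ∀ J ∈ O, ∀ J' ∈ O, J < J' → φ J < φ J') (hφlt : ∀ J ∈ O, J < φ J) {N : ℕ}
    (hφN : ∀ J ∈ O, countIco O J (φ J) ≤ N) (hψ : ∀ J ∈ O, ψ J ∈ O)
    (hψm : ∀ J ∈ O, ∀ J' ∈ O, J < J' → ψ J < ψ J') (hψlt : ∀ J ∈ O, J < ψ J) {N' : ℕ}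
    (hψN : ∀ J ∈ O, countIco O J (ψ J) ≤ N') :
    ∃ k l, 1 ≤ k ∧ 1 ≤ l ∧ ∃ J ∈ O, ∀ n, φ^[k * n] J = ψ^[l * n] J := by
  obtain ⟨r, hr, J1, hJ1, h1⟩ := exists_countIco_eq hO hφ hφm hφlt hφN
  obtain ⟨r', hr', J2, hJ2, h2⟩ := exists_countIco_eq hO hψ hψm hψlt hψN
  have hmem : ∀ {χ : ℕ → ℕ}, (∀ J ∈ O, χ J ∈ O) → (∀ J ∈ O, J < χ J) → ∀ J ∈ O, ∀ n,
      χ^[n] J ∈ O ∧ J ≤ χ^[n] J := by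
    intro χ hχ hlt J hJ n
    induction n with
    | zero => simp [hJ]
    | succ n ih =>
      rw [Function.iterate_succ_apply']
      exact ⟨hχ _ ih.1, ih.2.trans (hlt _ ih.1).le⟩
  have key : ∀ J ∈ O, J1 ≤ J → J2 ≤ J → ∀ n, φ^[r' * n] J = ψ^[r * n] J := by
    intro J hJ hj1 hj2 n
    obtain ⟨a1, a2⟩ := hmem hφ hφlt J hJ (r' * n)
    obtain ⟨b1, b2⟩ := hmem hψ hψlt J hJ (r * n)
    refine eq_of_countIco_eq a1 b1 a2 b2 ?_
    rw [h1 J hJ hj1, h2 J hJ hj2]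
    ring
  rcases le_total J1 J2 with h | h
  · exact ⟨r', r, hr', hr, J2, hJ2, key J2 hJ2 h le_rfl⟩
  · exact ⟨r', r, hr', hr, J1, hJ1, key J1 hJ1 le_rfl h⟩

end Count

/-! ### Growth exponents. -/

/-- The sequence `f (f (⋯ (f 1)))` grows like `exp (a n)` up to subexponential factors. -/
def HasGrowthExponent (f : ℕ → ℕ) (a : ℝ) : Prop :=
  Tendsto (fun n : ℕ => Real.log (f^[n] 1) / n) atTop (nhds a)

section Growth

variable {A : Type*} {x : ℕ → A} {f : ℕ → ℕ} {a : ℝ}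

theorem HasGrowthExponent.iterate (h : HasGrowthExponent f a) {p : ℕ} (hp : 1 ≤ p) :
    HasGrowthExponent f^[p] (p * a) := by
  unfold HasGrowthExponent at *
  have h1 : Tendsto (fun n : ℕ => p * n) atTop atTop :=
    tendsto_id.const_mul_atTop' (by omega)
  have h2 := (h.comp h1).const_mul (p : ℝ)
  refine h2.congr fun n => ?_
  simp only [Function.comp, Function.iterate_mul, Nat.cast_mul]
  have : (p : ℝ) ≠ 0 := by positivity
  rcases eq_or_ne (n : ℝ) 0 with hn | hn
  · simp [hn]
  · field_simp

/-- A sequence squeezed between orbits of `f` has the growth exponent of `f`. -/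
theorem IsIdemCut.tendsto_log (hf : IsIdemCut x f) (h : HasGrowthExponent f a) {u : ℕ → ℕ} {P : ℕ}
    (h1 : ∀ n, f^[n] 1 ≤ u n) (h2 : ∀ n, u n ≤ f^[n] P) :
    Tendsto (fun n : ℕ => Real.log (u n) / n) atTop (nhds a) := by
  -- The starting point `P` is absorbed by `P` further iterations, which do not affect the exponent.
  have h3 : ∀ n, u n ≤ f^[n + P] 1 := by
    intro n
    refine (h2 n).trans ?_
    rw [Function.iterate_add]
    refine (hf.toIsCut.iterate n).mono (le_trans ?_ (hf.iterate_one_ge P))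
    exact Nat.lt_two_pow_self.le
  have hpos : ∀ n, 1 ≤ f^[n] 1 := fun n => Nat.one_le_two_pow.trans (hf.iterate_one_ge n)
  have h4 : Tendsto (fun n : ℕ => Real.log (f^[n + P] 1) / n) atTop (nhds a) := by
    have e1 : Tendsto (fun n : ℕ => Real.log (f^[n + P] 1) / ((n + P : ℕ) : ℝ)) atTop (nhds a) :=
      h.comp (tendsto_add_atTop_nat P)
    have e2 : Tendsto (fun n : ℕ => ((n + P : ℕ) : ℝ) / n) atTop (nhds 1) := by
      have : Tendsto (fun n : ℕ => 1 + (P : ℝ) / n) atTop (nhds (1 + 0)) :=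
        tendsto_const_nhds.add (tendsto_const_div_atTop_nhds_zero_nat _)
      rw [add_zero] at this
      refine this.congr' ?_
      filter_upwards [eventually_ge_atTop 1] with n hn
      have : (n : ℝ) ≠ 0 := by positivity
      push_cast; field_simp
    have := e1.mul e2
    rw [mul_one] at this
    refine this.congr' ?_
    filter_upwards [eventually_ge_atTop 1] with n hn
    have h5 : (n : ℝ) ≠ 0 := by positivity
    have h6 : ((n + P : ℕ) : ℝ) ≠ 0 := by positivity
    field_simp
  refine tendsto_of_tendsto_of_tendsto_of_le_of_le h h4 (fun n => ?_) (fun n => ?_)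
  · have := hpos n
    have := h1 n
    dsimp only
    gcongr
  · have := hpos n
    have := h1 n
    have := h3 n
    have : 1 ≤ u n := by omega
    dsimp only
    gcongr

theorem IsIdemCut.growth_pos (hf : IsIdemCut x f) (h : HasGrowthExponent f a) : 0 < a := by
  have : Real.log 2 ≤ a := by
    refine ge_of_tendsto h ?_
    filter_upwards [eventually_ge_atTop 1] with n hn
    have h5 : (0 : ℝ) < n := by positivity
    rw [le_div_iff₀ h5, mul_comm, ← Real.log_pow]
    refine Real.log_le_log (by positivity) ?_
    exact_mod_cast hf.iterate_one_ge n
  exact (Real.log_pos (by norm_num)).trans_le this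

end Growth

/-! ### Minimal unbounded alphabets and leaf cuts. -/

/-- Arbitrarily long words over the alphabet `D` occur in `x`. -/
def IsUnboundedAlphabet {A : Type*} (x : ℕ → A) (D : Set A) : Prop :=
  ∀ L, ∃ i, ∀ s < L, x (i + s) ∈ D

/-- The cut `f` maps every letter of `B` to a word over `B` in which all letters of `B` occur at
least twice. -/
structure IsLeafCut {A : Type*} (x : ℕ → A) (B : Set A) (f : ℕ → ℕ) : Prop
    extends IsIdemCut x f where
  sub : ∀ i, x i ∈ B → ∀ s, f i ≤ s → s < f (i + 1) → x s ∈ B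
  twice : ∀ i, x i ∈ B → ∀ b ∈ B, ∃ s t, f i ≤ s ∧ s < t ∧ t < f (i + 1) ∧ x s = b ∧ x t = b

section Leaf

variable {A : Type*} {x : ℕ → A} {f g : ℕ → ℕ} {B : Set A}

theorem exists_minimal_unboundedAlphabet [Finite A] (x : ℕ → A) :
    ∃ B, Minimal (IsUnboundedAlphabet x) B :=
  (Set.toFinite {D | IsUnboundedAlphabet x D}).exists_minimal
    ⟨Set.univ, fun _ => ⟨0, fun _ _ => Set.mem_univ _⟩⟩

/-- Iterating lengthens the block of `j` without bound, while idempotence keeps its letters the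
same. -/
theorem IsIdemCut.unbounded_cutLetters (hf : IsIdemCut x f) (j : ℕ) :
    IsUnboundedAlphabet x (cutLetters x f j) := by
  intro L
  refine ⟨f^[L + 1] j, fun s hs => ?_⟩
  rw [← hf.iterate_letters (n := L + 1) (by omega)]
  refine ⟨_, ⟨Nat.le_add_right _ _, ?_⟩, rfl⟩
  have h1 := hf.pow_le (L + 1) j
  have h2 := Nat.lt_two_pow_self (n := L + 1)
  omega

/-- A word over `B` of length `2 * M` contains a whole block. The letter set of that block is
unbounded and contained in `B`, hence equals `B` by minimality. By idempotence the block of each of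
its letters also stays in `B`, and minimality applies again. -/
theorem IsIdemCut.cutLetters_eq [Finite A] (hf : IsIdemCut x f)
    (hB : Minimal (IsUnboundedAlphabet x) B) {i : ℕ} (hi : x i ∈ B) : cutLetters x f i = B := by
  have key : ∀ j, cutLetters x f j ⊆ B → cutLetters x f j = B := fun j hj =>
    hj.antisymm (hB.2 (hf.unbounded_cutLetters j) hj)
  obtain ⟨M, hM1, hM⟩ := hf.toIsCut.exists_bound
  obtain ⟨j, hj⟩ := hB.1 (2 * M)
  obtain ⟨k, hk1, hk2⟩ := hf.toIsCut.exists_block j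
  have h1 := hM k
  have h2 := hM (k + 1)
  have hk : cutLetters x f (k + 1) = B := by
    refine key _ ?_
    rintro _ ⟨s, ⟨hs1, hs2⟩, rfl⟩
    have := hj (s - j) (by omega)
    rwa [show j + (s - j) = s by omega] at this
  have h3 : x i ∈ cutLetters x f (k + 1) := hk ▸ hi
  obtain ⟨s, hs, hsi⟩ := h3
  rw [← cutLetters_congr hf.toIsCut hsi]
  refine key _ fun b hb => ?_
  rw [← hk, ← hf.idem]
  exact (mem_cutLetters_comp hf.toIsCut).2 ⟨s, hs, hb⟩

/-- The square of an idempotent cut is a leaf cut for all minimal unbounded alphabets. -/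
theorem IsIdemCut.isLeafCut [Finite A] (hf : IsIdemCut x f)
    (hB : Minimal (IsUnboundedAlphabet x) B) : IsLeafCut x B f^[2] where
  toIsIdemCut := hf.iterate (by norm_num)
  sub i hi s h1 h2 := by
    rw [← (hf.iterate (n := 2) (by norm_num)).cutLetters_eq hB hi]
    exact ⟨s, ⟨h1, h2⟩, rfl⟩
  twice i hi b hb := by
    have h2 := hf.two_le i
    have hmem : ∀ s, f i ≤ s → s < f (i + 1) → ∃ t, f s ≤ t ∧ t < f (s + 1) ∧ x t = b := by
      intro s hs1 hs2
      have hs : x s ∈ B := by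
        rw [← hf.cutLetters_eq hB hi]; exact ⟨s, ⟨hs1, hs2⟩, rfl⟩
      rw [← hf.cutLetters_eq hB hs] at hb
      obtain ⟨t, ht, rfl⟩ := hb
      exact ⟨t, ht.1, ht.2, rfl⟩
    obtain ⟨s, hs1, hs2, hs3⟩ := hmem (f i) le_rfl (by omega)
    obtain ⟨t, ht1, ht2, ht3⟩ := hmem (f i + 1) (by omega) (by omega)
    exact ⟨s, t, hs1, by omega, lt_of_lt_of_le ht2 (hf.toIsCut.mono (by omega)), hs3, ht3⟩

/-- An interval all of whose blocks are words over `B` is itself a word over `B`, up to its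
ends. -/
theorem IsIdemCut.interior_mem (hf : IsIdemCut x f) {M : ℕ} (hM : ∀ i, f (i + 1) ≤ f i + M)
    {i j : ℕ} (h : ∀ s, f i ≤ s → s < f j → x s ∈ B) {s : ℕ} (h1 : i + M ≤ s)
    (h2 : s + M ≤ j) : x s ∈ B := by
  -- The margin `M` places the block of index `k` around `s` inside `[i, j)`. By idempotence its
  -- letters are those of its `f`-image, which lies in `[f i, f j)`.
  obtain ⟨k, hk1, hk2⟩ := hf.toIsCut.exists_block s
  have h3 := hM k
  have h4 : x s ∈ cutLetters x f k := ⟨s, ⟨hk1, hk2⟩, rfl⟩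
  rw [← hf.idem] at h4
  obtain ⟨t, ⟨ht1, ht2⟩, hts⟩ := h4
  rw [← hts]
  exact h t ((hf.toIsCut.mono (by omega)).trans ht1)
    (lt_of_lt_of_le ht2 (hf.toIsCut.mono (by omega)))

/-- The largest length of a `G`-block of a letter of `B`. -/
noncomputable def leafMax (x : ℕ → A) (B : Set A) (G : ℕ → ℕ) : ℕ :=
  sSup {ℓ | ∃ i, x i ∈ B ∧ G i + ℓ = G (i + 1)}

theorem IsCut.le_leafMax [Finite A] (hG : IsCut x g) {i : ℕ} (hi : x i ∈ B) :
    g (i + 1) ≤ g i + leafMax x B g := by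
  obtain ⟨M, -, hM⟩ := hG.exists_bound
  have h1 := hG.lt_succ i
  have : g (i + 1) - g i ≤ leafMax x B g := by
    refine le_csSup ⟨M, ?_⟩ ⟨i, hi, by omega⟩
    rintro ℓ ⟨j, -, hj⟩
    have := hM j
    omega
  omega

theorem IsCut.exists_leafMax [Finite A] (hG : IsCut x g) (hB : ∃ i, x i ∈ B) :
    ∃ i, x i ∈ B ∧ g i + leafMax x B g = g (i + 1) := by
  obtain ⟨M, -, hM⟩ := hG.exists_bound
  obtain ⟨i, hi⟩ := hB
  have h1 := hG.lt_succ i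
  refine Nat.sSup_mem (s := {ℓ | ∃ i, x i ∈ B ∧ g i + ℓ = g (i + 1)})
    ⟨g (i + 1) - g i, i, hi, by omega⟩ ⟨M, ?_⟩
  rintro ℓ ⟨j, -, hj⟩
  have := hM j
  omega

theorem leafMax_id (hB : ∃ i, x i ∈ B) : leafMax x B id = 1 := by
  obtain ⟨i, hi⟩ := hB
  have : {ℓ | ∃ i, x i ∈ B ∧ id i + ℓ = id (i + 1)} = {1} := by
    ext ℓ
    constructor
    · rintro ⟨j, -, hj⟩
      simp at hj; exact hj
    · rintro rfl
      exact ⟨i, hi, rfl⟩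
  rw [leafMax, this, csSup_singleton]

/-- `|G(f(b))|` is at least twice `|G(b')|` for letters `b`, `b'` of `B`. -/
theorem IsLeafCut.two_mul_leafMax_le [Finite A] (hf : IsLeafCut x B f) (hG : IsCut x g) {i : ℕ}
    (hi : x i ∈ B) : g (f i) + 2 * leafMax x B g ≤ g (f (i + 1)) := by
  obtain ⟨k, hk, hkm⟩ := hG.exists_leafMax ⟨i, hi⟩
  obtain ⟨s, t, h1, h2, h3, h4, h5⟩ := hf.twice i hi _ hk
  have e1 := hG.len _ _ h4
  have e2 := hG.len _ _ h5
  have e3 := hG.mono h1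
  have e4 := hG.mono (show s + 1 ≤ t from h2)
  have e5 := hG.mono (show t + 1 ≤ f (i + 1) from h3)
  omega

theorem IsLeafCut.two_mul_leafMax_le_comp [Finite A] (hf : IsLeafCut x B f) (hG : IsCut x g)
    (hB : ∃ i, x i ∈ B) : 2 * leafMax x B g ≤ leafMax x B (g ∘ f) := by
  obtain ⟨i, hi⟩ := hB
  have h1 := hf.two_mul_leafMax_le hG hi
  have h2 := (hG.comp hf.toIsCut).le_leafMax hi
  simp only [Function.comp] at h2
  omega

/-- The `G`-length of a word over `B`. -/
theorem IsCut.word_le_leafMax [Finite A] (hG : IsCut x g) {i j : ℕ} (hij : i ≤ j)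
    (h : ∀ s, i ≤ s → s < j → x s ∈ B) : g j ≤ g i + (j - i) * leafMax x B g :=
  IsCut.sub_le_mul (fun k h1 h2 => hG.le_leafMax (h k h1 h2)) hij

theorem IsLeafCut.comp_block_le [Finite A] (hf : IsLeafCut x B f) (hG : IsCut x g) {M : ℕ}
    (hM : ∀ i, f (i + 1) ≤ f i + M) {k : ℕ} (hk : ∀ s, f k ≤ s → s < f (k + 1) → x s ∈ B) :
    g (f (k + 1)) ≤ g (f k) + M * leafMax x B g := by
  have h1 := hG.word_le_leafMax (hf.mono (Nat.le_succ k)) hk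
  have h2 : (f (k + 1) - f k) * leafMax x B g ≤ M * leafMax x B g :=
    Nat.mul_le_mul_right _ (by have := hM k; omega)
  simp only [Nat.succ_eq_add_one] at h1
  omega

/-- Desubstitution of a word over `B`: up to boundedly many letters, it is the `f`-image of a word
over `B`. -/
theorem IsLeafCut.desubst [Finite A] (hf : IsLeafCut x B f) (hG : IsCut x g) {M : ℕ}
    (hM : ∀ i, f (i + 1) ≤ f i + M) {i j P : ℕ} (hij : i ≤ j) (hj : j ≤ f P)
    (h : ∀ s, i ≤ s → s < j → x s ∈ B) :
    ∃ i' j', i' ≤ j' ∧ j' ≤ P ∧ (∀ s, i' ≤ s → s < j' → x s ∈ B) ∧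
      g j + g (f i') ≤ g i + g (f j') + (2 * M + 2 * M * M) * leafMax x B g := by
  obtain ⟨k, hk1, hk2⟩ := hf.exists_block i
  obtain ⟨l, hl1, hl2⟩ := hf.exists_block j
  have hk3 := hM k
  have hl3 := hM l
  have hlP : l ≤ P := hf.strictMono.le_iff_le.1 (hl1.trans hj)
  by_cases hkl : l < k + 1
  · refine ⟨0, 0, le_rfl, Nat.zero_le _, fun s _ hs => absurd hs (Nat.not_lt_zero s), ?_⟩
    have h1 := hG.word_le_leafMax hij h
    have h2 : f (l + 1) ≤ f (k + 1) := hf.mono (by omega)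
    have h3 : (j - i) * leafMax x B g ≤ (2 * M + 2 * M * M) * leafMax x B g := by
      refine Nat.mul_le_mul_right _ ?_
      nlinarith [show j - i ≤ M by omega]
    omega
  -- The error constant has two sources: at most `M` letters in each of the two incomplete end
  -- blocks, and at most `M` full blocks, each of at most `M` letters, trimmed at each end. If at
  -- most `2 * M` full blocks are present, all of them go into the error.
  push Not at hkl
  have hlk := hf.mono hkl
  have e1 : g (f (k + 1)) ≤ g i + M * leafMax x B g :=
    (hG.word_le_leafMax hk2.le fun s hs hs' => h s hs (by omega)).trans
      (Nat.add_le_add_left (Nat.mul_le_mul_right _ (by omega)) _)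
  have e2 : g j ≤ g (f l) + M * leafMax x B g :=
    (hG.word_le_leafMax hl1 fun s hs hs' => h s (by omega) hs').trans
      (Nat.add_le_add_left (Nat.mul_le_mul_right _ (by omega)) _)
  have hblock : ∀ q, k + 1 ≤ q → q < l → g (f (q + 1)) ≤ g (f q) + M * leafMax x B g := by
    intro q hq1 hq2
    have := hf.mono hq1
    have := hf.mono (show q + 1 ≤ l from hq2)
    exact hf.comp_block_le hG hM fun s hs1 hs2 => h s (by omega) (by omega)
  by_cases hlen : l ≤ k + 1 + 2 * M
  · refine ⟨0, 0, le_rfl, Nat.zero_le _, fun s _ hs => absurd hs (Nat.not_lt_zero s), ?_⟩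
    have h1 := IsCut.sub_le_mul (G := g ∘ f) hblock hkl
    simp only [Function.comp] at h1
    have h3 : (l - (k + 1)) * (M * leafMax x B g) ≤ 2 * M * (M * leafMax x B g) :=
      Nat.mul_le_mul_right _ (by omega)
    nlinarith
  · push Not at hlen
    -- A letter whose image is over `B` need not lie in `B`. Trimming `M` letters on each side makes
    -- `IsIdemCut.interior_mem` applicable.
    have hm1 := IsCut.sub_le_mul (G := g ∘ f) (i := k + 1) (j := k + 1 + M)
      (fun q hq1 hq2 => hblock q hq1 (by omega)) (by omega)
    have hm2 := IsCut.sub_le_mul (G := g ∘ f) (i := l - M) (j := l)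
      (fun q hq1 hq2 => hblock q (by omega) hq2) (by omega)
    rw [show k + 1 + M - (k + 1) = M by omega] at hm1
    rw [show l - (l - M) = M by omega] at hm2
    simp only [Function.comp] at hm1 hm2
    refine ⟨k + 1 + M, l - M, by omega, by omega, fun s hs1 hs2 => ?_, ?_⟩
    · exact hf.interior_mem hM (i := k + 1) (j := l)
        (fun t ht1 ht2 => h t (by omega) (by omega)) hs1 (by omega)
    · nlinarith

end Leaf

/-! ### Length estimates uniform over all compositions of the two cuts. -/

/-- The composition of the maps `h b` for the letters `b` of `w`. -/
def cutWord (h : Bool → ℕ → ℕ) : List Bool → ℕ → ℕ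
  | [] => id
  | b :: w => h b ∘ cutWord h w

section Word

variable {A : Type*} {x : ℕ → A} {B : Set A} {h : Bool → ℕ → ℕ}

theorem cutWord_append (h : Bool → ℕ → ℕ) (v w : List Bool) :
    cutWord h (v ++ w) = cutWord h v ∘ cutWord h w := by
  induction v with
  | nil => rfl
  | cons b v ih => simp only [List.cons_append, cutWord, ih]; rfl

theorem cutWord_replicate (h : Bool → ℕ → ℕ) (b : Bool) (n : ℕ) :
    cutWord h (List.replicate n b) = (h b)^[n] := by
  induction n with
  | zero => rfl
  | succ n ih => rw [List.replicate_succ, cutWord, ih, Function.iterate_succ']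

theorem isCut_cutWord (hh : ∀ b, IsLeafCut x B (h b)) (w : List Bool) :
    IsCut x (cutWord h w) := by
  induction w with
  | nil => exact IsCut.id x
  | cons b w ih => exact (hh b).toIsCut.comp ih

theorem exists_common_bound [Finite A] (hh : ∀ b, IsLeafCut x B (h b)) :
    ∃ M, 1 ≤ M ∧ ∀ b i, h b (i + 1) ≤ h b i + M := by
  obtain ⟨M1, h1, h1'⟩ := (hh true).toIsCut.exists_bound
  obtain ⟨M2, h2, h2'⟩ := (hh false).toIsCut.exists_bound
  refine ⟨M1 + M2, by omega, fun b i => ?_⟩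
  cases b
  · have := h2' i; omega
  · have := h1' i; omega

/-- Words over `B` that occur in `x` before the position `F P` are, up to a factor, at most as long
as the `F`-blocks of letters of `B`, uniformly in the composition `F`. -/
theorem exists_leafWord_le [Finite A] (hh : ∀ b, IsLeafCut x B (h b)) (hB : ∃ i, x i ∈ B)
    (P : ℕ) : ∃ C, ∀ w i j, i ≤ j → j ≤ cutWord h w P → (∀ s, i ≤ s → s < j → x s ∈ B) →
      j ≤ i + C * leafMax x B (cutWord h w) := by
  obtain ⟨M, hM1, hM⟩ := exists_common_bound hh
  set C2 := 2 * M + 2 * M * M with hC2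
  -- The extra term `C2 * leafMax x B G` on the left keeps the constant independent of the length of
  -- `w`: each desubstitution costs one more such term, and `leafMax` at least doubles from `G` to
  -- `G ∘ h b`, which pays for both.
  have key : ∀ w (G : ℕ → ℕ), IsCut x G → ∀ i j, i ≤ j → j ≤ cutWord h w P →
      (∀ s, i ≤ s → s < j → x s ∈ B) →
      G j + C2 * leafMax x B G ≤ G i + (P + C2) * leafMax x B (G ∘ cutWord h w) := by
    intro w
    induction w with
    | nil =>
      intro G hG i j hij hj hs
      have h1 := hG.word_le_leafMax hij hs
      have hj' : j ≤ P := hj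
      have h2 : (j - i) * leafMax x B G ≤ P * leafMax x B G := Nat.mul_le_mul_right _ (by omega)
      simp only [cutWord, Function.comp_id]
      nlinarith
    | cons b w ih =>
      intro G hG i j hij hj hs
      obtain ⟨i', j', hij', hj', hs', hle⟩ := (hh b).desubst hG (hM b) hij hj hs
      have h1 := ih (G ∘ h b) (hG.comp (hh b).toIsCut) i' j' hij' hj' hs'
      have h2 := (hh b).two_mul_leafMax_le_comp hG hB
      have h3 : C2 * (2 * leafMax x B G) ≤ C2 * leafMax x B (G ∘ h b) := Nat.mul_le_mul_left _ h2
      simp only [cutWord, ← Function.comp_assoc]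
      simp only [Function.comp_apply] at h1
      nlinarith
  refine ⟨P + C2, fun w i j hij hj hs => ?_⟩
  have := key w id (IsCut.id x) i j hij hj hs
  simp only [id, Function.id_comp] at this
  omega

/-- The blocks of the letters of `B` have comparable lengths. -/
theorem leafMax_le_mul_block [Finite A] (hh : ∀ b, IsLeafCut x B (h b)) {M : ℕ} (hM1 : 1 ≤ M)
    (hM : ∀ b i, h b (i + 1) ≤ h b i + M) (w : List Bool) {k : ℕ} (hk : x k ∈ B) :
    leafMax x B (cutWord h w) + M * cutWord h w k ≤ M * cutWord h w (k + 1) := by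
  rcases List.eq_nil_or_concat w with rfl | ⟨v, b, rfl⟩
  · simp only [cutWord, leafMax_id ⟨k, hk⟩, id]
    nlinarith
  -- The innermost map is split off. Under `h b` every letter of `B` becomes a word of at most `M`
  -- letters containing all of `B`, so every composite block is at least twice, and at most `M`
  -- times, the largest `v`-block of a letter of `B`.
  · rw [List.concat_eq_append, cutWord_append]
    have hv := isCut_cutWord hh v
    have e : cutWord h [b] = h b := rfl
    rw [e]
    have h1 := (hh b).two_mul_leafMax_le hv hk
    obtain ⟨i, hi, him⟩ := (hv.comp (hh b).toIsCut).exists_leafMax ⟨k, hk⟩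
    have h2 := (hh b).comp_block_le hv (hM b) (k := i) fun s => (hh b).sub i hi s
    simp only [Function.comp_apply] at him ⊢
    nlinarith

/-- Positions are distorted boundedly, uniformly in the composition. -/
theorem exists_cutWord_le (hh : ∀ b, IsLeafCut x B (h b)) (P : ℕ) :
    ∃ C, ∀ w, cutWord h w P ≤ C * cutWord h w 1 := by
  refine ⟨P + h true P + h false P, fun w => ?_⟩
  rcases List.eq_nil_or_concat w with rfl | ⟨v, b, rfl⟩
  · simp only [cutWord, id]; omega
  · rw [List.concat_eq_append, cutWord_append]
    have hv := isCut_cutWord hh v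
    have e : cutWord h [b] = h b := rfl
    rw [e]
    simp only [Function.comp_apply]
    -- Every letter already occurs before position `h b 1`, so the prefix of length `h b 1` has a
    -- `v`-image at least as long as any `v`-block.
    have h1 : ∀ k, 0 ≤ k → k < h b P →
        cutWord h v (k + 1) ≤ cutWord h v k + cutWord h v (h b 1) := by
      intro k _ _
      obtain ⟨i, hi, hik⟩ := (hh b).exists_lt_one k
      have e1 := hv.len i k hik
      have e2 := hv.mono (show i + 1 ≤ h b 1 from hi)
      omega
    have h2 := IsCut.sub_le_mul h1 (Nat.zero_le _)
    rw [hv.zero, zero_add, Nat.sub_zero] at h2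
    refine h2.trans (Nat.mul_le_mul_right _ ?_)
    cases b <;> omega

end Word

/-! ### Ends of runs over `B`, and why runs must eventually never end. -/

/-- The first position from `i` on at which the letter of `x` is not in `B`. -/
noncomputable def exitPos {A : Type*} (x : ℕ → A) (B : Set A) (i : ℕ) : ℕ :=
  sInf {k | i ≤ k ∧ x k ∉ B}

/-- A word over `B` of length `M` ends at position `J` and cannot be extended to the right. -/
structure IsRunEnd {A : Type*} (x : ℕ → A) (B : Set A) (M J : ℕ) : Prop where
  notMem : x J ∉ B
  le : M ≤ J
  mem : ∀ s, J ≤ s + M → s < J → x s ∈ B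

section Exit

variable {A : Type*} {x : ℕ → A} {B : Set A}

theorem exitPos_spec (hne : ∀ N, ∃ k, N ≤ k ∧ x k ∉ B) (i : ℕ) :
    i ≤ exitPos x B i ∧ x (exitPos x B i) ∉ B :=
  Nat.sInf_mem (s := {k | i ≤ k ∧ x k ∉ B}) (hne i)

theorem mem_of_lt_exitPos {i s : ℕ} (h1 : i ≤ s) (h2 : s < exitPos x B i) : x s ∈ B := by
  by_contra h
  exact Nat.notMem_of_lt_sInf h2 ⟨h1, h⟩

theorem exitPos_le {i k : ℕ} (h1 : i ≤ k) (h2 : x k ∉ B) : exitPos x B i ≤ k :=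
  Nat.sInf_le ⟨h1, h2⟩

theorem exitPos_eq (hne : ∀ N, ∃ k, N ≤ k ∧ x k ∉ B) {i j : ℕ} (hij : i ≤ j)
    (h : ∀ s, i ≤ s → s < j → x s ∈ B) : exitPos x B i = exitPos x B j := by
  obtain ⟨h1, h2⟩ := exitPos_spec hne i
  obtain ⟨h3, h4⟩ := exitPos_spec hne j
  refine le_antisymm (exitPos_le (hij.trans h3) h4) (exitPos_le ?_ h2)
  by_contra h5
  exact h2 (h _ h1 (by omega))

theorem exitPos_self (hne : ∀ N, ∃ k, N ≤ k ∧ x k ∉ B) {i : ℕ} (h : x i ∉ B) :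
    exitPos x B i = i :=
  le_antisymm (exitPos_le le_rfl h) (exitPos_spec hne i).1

theorem IsLeafCut.sub_interval {f : ℕ → ℕ} (hf : IsLeafCut x B f) {i j : ℕ}
    (h : ∀ s, i ≤ s → s < j → x s ∈ B) {s : ℕ} (h1 : f i ≤ s) (h2 : s < f j) : x s ∈ B := by
  obtain ⟨k, hk1, hk2⟩ := hf.exists_block s
  refine hf.sub k (h k ?_ ?_) s hk1 hk2
  · have := hf.strictMono.lt_iff_lt.1 (lt_of_le_of_lt h1 hk2); omega
  · exact hf.strictMono.lt_iff_lt.1 (lt_of_le_of_lt hk1 h2)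

/-- The letters from `i` to its exit lie in `B`, hence so do their images, and the two image
positions share their exit. It follows that `J ↦ exitPos x B (f J)` is compatible with composition
of cuts. -/
theorem IsLeafCut.exitPos_exitPos (hne : ∀ N, ∃ k, N ≤ k ∧ x k ∉ B) {f : ℕ → ℕ}
    (hf : IsLeafCut x B f) (i : ℕ) :
    exitPos x B (f (exitPos x B i)) = exitPos x B (f i) :=
  (exitPos_eq hne (hf.mono (exitPos_spec hne i).1) fun _ h1 h2 =>
    hf.sub_interval (fun _ h3 h4 => mem_of_lt_exitPos h3 h4) h1 h2).symm

theorem IsRunEnd.map (hne : ∀ N, ∃ k, N ≤ k ∧ x k ∉ B) {f : ℕ → ℕ} (hf : IsLeafCut x B f)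
    {M J : ℕ} (hJ : IsRunEnd x B M J) : IsRunEnd x B M (exitPos x B (f J)) := by
  obtain ⟨h1, h2⟩ := exitPos_spec hne (f J)
  have h3 := hf.add_le (J - M) M
  have h4 := hJ.le
  rw [Nat.sub_add_cancel h4] at h3
  refine ⟨h2, by omega, fun s hs1 hs2 => ?_⟩
  by_cases h5 : f J ≤ s
  · exact mem_of_lt_exitPos h5 hs2
  · exact hf.sub_interval (i := J - M) (j := J) (fun t ht1 ht2 => hJ.mem t (by omega) ht2)
      (by omega) (by omega)

/-- Were the image run to reach `f J'`, the whole image of `[J - M, J')` would be over `B`, and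
`IsIdemCut.interior_mem` would put `x J` itself in `B`. The right margin `J + M < J'` holds because
the `M` letters before `J'` lie in `B` and `x J` does not. -/
theorem IsRunEnd.exitPos_lt {f : ℕ → ℕ} (hf : IsLeafCut x B f) {M : ℕ}
    (hM : ∀ i, f (i + 1) ≤ f i + M) {J J' : ℕ} (hJ : IsRunEnd x B M J) (hJ' : IsRunEnd x B M J')
    (hlt : J < J') : exitPos x B (f J) < f J' := by
  by_contra hcon
  push Not at hcon
  have h1 : ¬ (J' ≤ J + M) := fun h => hJ.notMem (hJ'.mem J h hlt)
  refine hJ.notMem (hf.interior_mem hM (i := J - M) (j := J') (fun s hs1 hs2 => ?_) ?_ (by omega))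
  · by_cases h5 : f J ≤ s
    · exact mem_of_lt_exitPos h5 (by omega)
    · exact hf.sub_interval (i := J - M) (j := J) (fun t ht1 ht2 => hJ.mem t (by omega) ht2)
        (by omega) (by omega)
  · have := hJ.le; omega

theorem IsIdemCut.two_pow_mul_le {f : ℕ → ℕ} (hf : IsIdemCut x f) (n i : ℕ) :
    2 ^ n * i ≤ f^[n] i := by
  have := IsCut.mul_le_sub (G := f^[n]) (fun k _ _ => hf.pow_le n k) (Nat.zero_le i)
  rw [(hf.toIsCut.iterate n).zero] at this
  rw [mul_comm]; simpa using this

variable {h : Bool → ℕ → ℕ}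

/-- The ends of the runs obtained from the run ending at `J₀` by applying the maps `h b`. -/
def runOrbit (x : ℕ → A) (B : Set A) (h : Bool → ℕ → ℕ) (J₀ : ℕ) : Set ℕ :=
  {J | ∃ w, J = exitPos x B (cutWord h w J₀)}

theorem IsRunEnd.cutWord (hne : ∀ N, ∃ k, N ≤ k ∧ x k ∉ B) (hh : ∀ b, IsLeafCut x B (h b))
    {M J : ℕ} (hJ : IsRunEnd x B M J) (w : List Bool) :
    IsRunEnd x B M (exitPos x B (cutWord h w J)) := by
  induction w with
  | nil => simpa [_root_.cutWord, exitPos_self hne hJ.notMem] using hJ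
  | cons b w ih =>
    have := ih.map hne (hh b)
    rwa [(hh b).exitPos_exitPos hne] at this

theorem IsRunEnd.exitPos_cutWord_lt (hne : ∀ N, ∃ k, N ≤ k ∧ x k ∉ B)
    (hh : ∀ b, IsLeafCut x B (h b)) {M : ℕ} (hM : ∀ b i, h b (i + 1) ≤ h b i + M) {J J' : ℕ}
    (hJ : IsRunEnd x B M J) (hJ' : IsRunEnd x B M J') (hlt : J < J') (w : List Bool) :
    exitPos x B (_root_.cutWord h w J) < exitPos x B (_root_.cutWord h w J') := by
  induction w with
  | nil => simpa [_root_.cutWord, exitPos_self hne hJ.notMem, exitPos_self hne hJ'.notMem]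
  | cons b w ih =>
    have := (hJ.cutWord hne hh w).exitPos_lt (hh b) (hM b) (hJ'.cutWord hne hh w) ih
    have h2 := (exitPos_spec hne (h b (exitPos x B (_root_.cutWord h w J')))).1
    rw [(hh b).exitPos_exitPos hne] at this h2
    exact this.trans_le h2

/-- Otherwise both images would lie in one run and have the same exit. This bounds how far a run can
overshoot the image of its end. -/
theorem IsRunEnd.exitPos_cutWord_le (hne : ∀ N, ∃ k, N ≤ k ∧ x k ∉ B)
    (hh : ∀ b, IsLeafCut x B (h b)) {M : ℕ} (hM : ∀ b i, h b (i + 1) ≤ h b i + M) {J J' : ℕ}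
    (hJ : IsRunEnd x B M J) (hJ' : IsRunEnd x B M J') (hlt : J < J') (w : List Bool) :
    exitPos x B (_root_.cutWord h w J) ≤ _root_.cutWord h w J' := by
  by_contra hcon
  refine (hJ.exitPos_cutWord_lt hne hh hM hJ' hlt w).ne ?_
  exact exitPos_eq hne ((isCut_cutWord hh w).mono hlt.le) fun s hs1 hs2 =>
    mem_of_lt_exitPos hs1 (by omega)

theorem IsRunEnd.lt_exitPos (hne : ∀ N, ∃ k, N ≤ k ∧ x k ∉ B) {f : ℕ → ℕ}
    (hf : IsLeafCut x B f) {M J : ℕ} (hJ : IsRunEnd x B M J) (hM : 1 ≤ M) :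
    J < exitPos x B (f J) := by
  have h1 := (exitPos_spec hne (f J)).1
  have h2 := hf.two_pow_mul_le 1 J
  simp at h2
  have := hJ.le
  omega

set_option maxHeartbeats 1000000 in
/-- There are boundedly many run ends of the orbit between a run end and its image. -/
theorem exists_countIco_runOrbit_le [Finite A] (hne : ∀ N, ∃ k, N ≤ k ∧ x k ∉ B)
    (hh : ∀ b, IsLeafCut x B (h b)) {M : ℕ} (hM1 : 1 ≤ M)
    (hM : ∀ b i, h b (i + 1) ≤ h b i + M) {J₀ : ℕ} (hJ₀ : IsRunEnd x B M J₀) (b : Bool) :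
    ∃ N, ∀ J ∈ runOrbit x B h J₀,
      countIco (runOrbit x B h J₀) J (exitPos x B (h b J)) ≤ N := by
  classical
  have hJ1 : 1 ≤ J₀ := hM1.trans hJ₀.le
  have hxJ : x (J₀ - 1) ∈ B := hJ₀.mem _ (by omega) (by omega)
  have hB : ∃ i, x i ∈ B := ⟨_, hxJ⟩
  set f := h true with hfdef
  have hf : IsLeafCut x B f := hh true
  set P := exitPos x B (f J₀) with hP
  have hPend : IsRunEnd x B M P := hJ₀.map hne hf
  have hPlt : J₀ < P := hJ₀.lt_exitPos hne hf hM1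
  obtain ⟨C1, hC1⟩ := exists_leafWord_le hh hB P
  obtain ⟨C2, hC2⟩ := exists_leafWord_le hh hB 1
  obtain ⟨CV, hCV⟩ := exists_cutWord_le hh P
  obtain ⟨i1, hi1, hi1x⟩ := hf.exists_lt_one (J₀ - 1)
  have hi1B : x i1 ∈ B := hi1x ▸ hxJ
  -- `r` bounds the loss when the size of a run is compared with blocks of `f`-iterates. Going down
  -- `r` levels gains a factor `2 ^ r > r`.
  set r := M * M * C1 * C2 with hr
  set K := f^[r + 3 + M * CV] 1 with hK
  have hiter : ∀ n, cutWord h (List.replicate n true) = f^[n] := cutWord_replicate h true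
  have hcutn : ∀ n, IsCut x f^[n] := fun n => hf.toIsCut.iterate n
  refine ⟨K, ?_⟩
  rintro J ⟨v, rfl⟩
  set J := exitPos x B (cutWord h v J₀) with hJdef
  have hJend : IsRunEnd x B M J := hJ₀.cutWord hne hh v
  have hJpos : 1 ≤ J := hM1.trans hJend.le
  obtain ⟨n, hn1, hn2⟩ : ∃ n, f^[n] 1 ≤ J ∧ J < f^[n + 1] 1 := by
    have hex : ∃ n, J < f^[n + 1] 1 := ⟨J, by
      have h1 := hf.iterate_one_ge (J + 1)
      have h2 := Nat.lt_two_pow_self (n := J + 1)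
      omega⟩
    refine ⟨Nat.find hex, ?_, Nat.find_spec hex⟩
    rcases h0 : Nat.find hex with _ | k
    · simpa using hJpos
    · exact not_lt.1 (Nat.find_min hex (m := k) (by omega))
  -- Everything up to the image of `J` stays within boundedly many further `f`-levels of `J`, since
  -- `M * CV ≤ 2 ^ (M * CV)`.
  have hup : ∀ o, o < exitPos x B (h b J) → o < f^[n + 1 + M * CV] 1 := by
    intro o ho
    have e1 : exitPos x B (h b J) = exitPos x B (cutWord h (b :: v) J₀) :=
      (hh b).exitPos_exitPos hne _
    have e2 := hJ₀.exitPos_cutWord_le hne hh hM hPend hPlt (b :: v)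
    have e3 : cutWord h (b :: v) P = h b (cutWord h v P) := rfl
    have e4 := IsCut.sub_le_mul (G := h b) (fun k _ _ => hM b k) (Nat.zero_le (cutWord h v P))
    rw [(hh b).zero, Nat.sub_zero, zero_add] at e4
    have e5 := hCV v
    have e6 : cutWord h v 1 ≤ J :=
      ((isCut_cutWord hh v).mono hJ1).trans (exitPos_spec hne _).1
    have e7 := hf.two_pow_mul_le (M * CV) (f^[n + 1] 1)
    rw [← Function.iterate_add_apply, add_comm (M * CV)] at e7
    have e8 : M * CV * f^[n + 1] 1 ≤ 2 ^ (M * CV) * f^[n + 1] 1 :=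
      Nat.mul_le_mul_right _ Nat.lt_two_pow_self.le
    have e9 : cutWord h v P * M ≤ M * CV * f^[n + 1] 1 := by
      calc cutWord h v P * M ≤ CV * f^[n + 1] 1 * M := by gcongr; exact e5.trans (by gcongr; omega)
        _ = _ := by ring
    omega
  -- The run ending at `o` is long enough to contain a boundary `f^[q] k` with `q = n - (r + 2)`.
  -- That boundary determines `o` as its exit, and only `K` boundaries are available.
  have hsub : ∀ o ∈ runOrbit x B h J₀, J ≤ o → o < exitPos x B (h b J) →
      r + 2 ≤ n → ∃ k < K, o = exitPos x B (f^[n - (r + 2)] k) := by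
    rintro o ⟨w, rfl⟩ ho1 ho2 hnr
    obtain ⟨q, hq⟩ : ∃ q, n = q + (r + 2) := ⟨n - (r + 2), by omega⟩
    have hw := isCut_cutWord hh w
    set o := exitPos x B (cutWord h w J₀) with hodef
    set I := cutWord h w (J₀ - 1) with hI
    have hIlt : I < cutWord h w J₀ := hw.strictMono (by omega)
    have hoge : cutWord h w J₀ ≤ o := (exitPos_spec hne _).1
    have hIB : ∀ s, I ≤ s → s < o → x s ∈ B := by
      intro s hs1 hs2
      by_cases h1 : cutWord h w J₀ ≤ s
      · exact mem_of_lt_exitPos h1 hs2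
      · have : ∀ w s, cutWord h w (J₀ - 1) ≤ s → s < cutWord h w J₀ → x s ∈ B := by
          intro w
          induction w with
          | nil => intro s hs1 hs2; exact hJ₀.mem s (by simp [cutWord] at hs1; omega) hs2
          | cons c w ih => intro s hs1 hs2; exact (hh c).sub_interval ih hs1 hs2
        exact this w s hs1 (by omega)
    have hm1 : leafMax x B (cutWord h w) ≤ M * (o - I) := by
      have h1 := leafMax_le_mul_block hh hM1 hM w hxJ
      rw [show J₀ - 1 + 1 = J₀ by omega, ← hI] at h1
      have h2 : M * (o - I) + M * I = M * o := by rw [← mul_add]; congr 1; omega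
      have h3 : M * cutWord h w J₀ ≤ M * o := Nat.mul_le_mul_left _ hoge
      omega
    -- Since `f^[n] 1 ≤ o`, an `f^[n - 1]`-block of a letter of `B` occurs before `o`, hence before
    -- `cutWord h w P`. There the words over `B` are bounded by `C1 * leafMax x B (cutWord h w)`.
    have hm2 : leafMax x B f^[n - 1] ≤ M * (C1 * leafMax x B (cutWord h w)) := by
      have h1 := leafMax_le_mul_block hh hM1 hM (List.replicate (n - 1) true) hi1B
      rw [hiter] at h1
      have h2 : f^[n - 1] (i1 + 1) ≤ f^[n] 1 := by
        rw [show n = n - 1 + 1 by omega, Function.iterate_succ_apply]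
        exact (hcutn _).mono hi1
      have h3 : o ≤ cutWord h w P := hJ₀.exitPos_cutWord_le hne hh hM hPend hPlt w
      have h4 := hC1 w (f^[n - 1] i1) (f^[n - 1] (i1 + 1)) ((hcutn _).mono (by omega)) (by omega)
        (by
          have : ∀ m s, f^[m] i1 ≤ s → s < f^[m] (i1 + 1) → x s ∈ B := by
            intro m
            induction m with
            | zero =>
              intro s hs1 hs2
              simp only [Function.iterate_zero, id] at hs1 hs2
              rwa [show s = i1 by omega]
            | succ m ih =>
              intro s hs1 hs2
              rw [Function.iterate_succ_apply'] at hs1 hs2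
              exact hf.sub_interval ih hs1 hs2
          exact this _)
      have h5 := Nat.mul_le_mul_left M h4
      rw [mul_add] at h5
      omega
    obtain ⟨k, hk1, hk2⟩ := (hcutn q).exists_block I
    -- If the run fitted into a single `f^[q]`-block, a copy of it would occur before `f^[q + 1] 1`
    -- and be bounded by `C2 * leafMax x B f^[q + 1]`, giving `2 ^ r ≤ r`.
    have hko : f^[q] (k + 1) < o := by
      by_contra hcon
      push Not at hcon
      obtain ⟨k1, hk1', hk1x⟩ := hf.exists_lt_one k
      have h1 := (hcutn q).len k1 k hk1x
      have h2 : f^[q] (k1 + 1) ≤ f^[q + 1] 1 := by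
        rw [Function.iterate_succ_apply]
        exact (hcutn _).mono hk1'
      have h3 := hC2 (List.replicate (q + 1) true) (f^[q] k1 + (I - f^[q] k))
        (f^[q] k1 + (o - f^[q] k)) (by omega) (by rw [hiter]; omega) (by
          intro s hs1 hs2
          have h4 := (hcutn q).block k1 k hk1x (s - f^[q] k1) (by omega)
          rw [show f^[q] k1 + (s - f^[q] k1) = s by omega] at h4
          rw [h4]
          exact hIB _ (by omega) (by omega))
      rw [hiter] at h3
      have h4 : o - I ≤ C2 * leafMax x B f^[q + 1] := by omega
      have h5 : ∀ t, 2 ^ t * leafMax x B f^[q + 1] ≤ leafMax x B f^[q + 1 + t] := by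
        intro t
        induction t with
        | zero => simp
        | succ t ih =>
          have := hf.two_mul_leafMax_le_comp (hcutn (q + 1 + t)) hB
          rw [← Function.iterate_succ] at this
          rw [pow_succ, show q + 1 + (t + 1) = (q + 1 + t).succ by rfl]
          refine le_trans ?_ this
          rw [mul_comm (2 ^ t) 2, mul_assoc]
          exact Nat.mul_le_mul_left _ ih
      have h6 := h5 r
      rw [show q + 1 + r = n - 1 by omega] at h6
      have h7 : 1 ≤ leafMax x B f^[q + 1] := by
        have h8 := (hcutn (q + 1)).le_leafMax hxJ
        have h9 := (hcutn (q + 1)).lt_succ (J₀ - 1)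
        omega
      have h8 : leafMax x B f^[n - 1] ≤ r * leafMax x B f^[q + 1] := by
        calc leafMax x B f^[n - 1] ≤ M * (C1 * leafMax x B (cutWord h w)) := hm2
          _ ≤ M * (C1 * (M * (C2 * leafMax x B f^[q + 1]))) := by
            gcongr
            exact hm1.trans (Nat.mul_le_mul_left _ h4)
          _ = _ := by rw [hr]; ring
      exact absurd (h6.trans h8) (not_le.2 (Nat.mul_lt_mul_of_pos_right Nat.lt_two_pow_self h7))
    refine ⟨k + 1, ?_, ?_⟩
    · have h1 := hup o ho2
      rw [show n + 1 + M * CV = q + (r + 3 + M * CV) by omega, Function.iterate_add_apply] at h1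
      exact (hcutn q).strictMono.lt_iff_lt.1 (hko.trans h1)
    · rw [show n - (r + 2) = q by omega, ← exitPos_eq hne hk2.le fun s hs1 hs2 =>
        hIB s hs1 (by omega)]
      rw [exitPos_eq hne (show I ≤ o by omega) hIB]
      exact (exitPos_self hne (exitPos_spec hne _).2).symm
  unfold countIco
  by_cases hnr : r + 2 ≤ n
  · calc _ ≤ ((Finset.range K).image fun k => exitPos x B (f^[n - (r + 2)] k)).card := by
          refine Finset.card_le_card fun o ho => ?_
          simp only [Finset.mem_filter, Finset.mem_Ico] at ho
          obtain ⟨k, hk, hok⟩ := hsub o ho.2 ho.1.1 ho.1.2 hnr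
          exact Finset.mem_image.2 ⟨k, Finset.mem_range.2 hk, hok.symm⟩
      _ ≤ K := Finset.card_image_le.trans (by simp)
  -- For small `n` all the points in question are themselves below `K`.
  · calc _ ≤ (Finset.range K).card := by
          refine Finset.card_le_card fun o ho => ?_
          simp only [Finset.mem_filter, Finset.mem_Ico] at ho
          refine Finset.mem_range.2 ((hup o ho.1.2).trans_le ?_)
          refine monotone_nat_of_le_succ (f := fun m => f^[m] 1) (fun m => ?_) (by omega)
          rw [Function.iterate_succ_apply']
          exact hf.le_apply _
      _ = K := by simp

/-- If the growth exponents of two cuts of `x` are rationally independent, then `x` is eventually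
a sequence over a minimal unbounded alphabet. -/
theorem eventually_mem_leaf [Finite A] (hh : ∀ b, IsLeafCut x B (h b))
    (hB : IsUnboundedAlphabet x B) {a : Bool → ℝ} (ha : ∀ b, HasGrowthExponent (h b) (a b))
    (hind : ∀ k l : ℕ, 0 < k → 0 < l → k * a true ≠ l * a false) :
    ∃ N, ∀ k, N ≤ k → x k ∈ B := by
  by_contra hcon
  have hne : ∀ N, ∃ k, N ≤ k ∧ x k ∉ B := by
    intro N
    by_contra h
    push Not at h
    exact hcon ⟨N, h⟩
  obtain ⟨M, hM1, hM⟩ := exists_common_bound hh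
  obtain ⟨i, hi⟩ := hB M
  have hrun : IsRunEnd x B M (exitPos x B (i + M)) := by
    obtain ⟨h1, h2⟩ := exitPos_spec hne (i + M)
    refine ⟨h2, by omega, fun s hs1 hs2 => ?_⟩
    by_cases h3 : i + M ≤ s
    · exact mem_of_lt_exitPos h3 hs2
    · have := hi (s - i) (by omega)
      rwa [show i + (s - i) = s by omega] at this
  set J₀ := exitPos x B (i + M)
  have hend : ∀ J ∈ runOrbit x B h J₀, IsRunEnd x B M J := by
    rintro _ ⟨w, rfl⟩
    exact hrun.cutWord hne hh w
  have hmap : ∀ b, ∀ J ∈ runOrbit x B h J₀, exitPos x B (h b J) ∈ runOrbit x B h J₀ := by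
    rintro b _ ⟨w, rfl⟩
    exact ⟨b :: w, (hh b).exitPos_exitPos hne _⟩
  have hmono : ∀ b, ∀ J ∈ runOrbit x B h J₀, ∀ J' ∈ runOrbit x B h J₀, J < J' →
      exitPos x B (h b J) < exitPos x B (h b J') := fun b J hJ J' hJ' hlt =>
    ((hend J hJ).exitPos_lt (hh b) (hM b) (hend J' hJ') hlt).trans_le (exitPos_spec hne _).1
  have hlt : ∀ b, ∀ J ∈ runOrbit x B h J₀, J < exitPos x B (h b J) := fun b J hJ =>
    (hend J hJ).lt_exitPos hne (hh b) hM1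
  have hnonempty : (runOrbit x B h J₀).Nonempty := ⟨_, [], rfl⟩
  choose N hN using exists_countIco_runOrbit_le hne hh hM1 hM hrun
  obtain ⟨k, l, hk, hl, J, hJ, heq⟩ := exists_iterate_eq (φ := fun J => exitPos x B (h true J))
    (ψ := fun J => exitPos x B (h false J)) hnonempty (hmap true) (hmono true) (hlt true)
    (hN true) (hmap false) (hmono false) (hlt false) (hN false)
  -- The orbit of `J` under the exit map is squeezed between two orbits of the cut `h b`, so it has
  -- exponent `a b`. Since iterates of the two exit maps agree at `J`, this makes the exponents
  -- dependent.
  have hlim : ∀ b, Tendsto (fun n : ℕ =>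
      Real.log (((fun J => exitPos x B (h b J))^[n] J : ℕ) : ℝ) / n) atTop (nhds (a b)) := by
    intro b
    have e0 : ∀ n, (fun J => exitPos x B (h b J))^[n] J =
        exitPos x B (cutWord h (List.replicate n b) J) := by
      intro n
      induction n with
      | zero => exact (exitPos_self hne (hend J hJ).notMem).symm
      | succ n ih =>
        rw [Function.iterate_succ_apply', ih]
        exact (hh b).exitPos_exitPos hne _
    refine (hh b).tendsto_log (ha b) (P := exitPos x B (h b J)) (fun n => ?_) fun n => ?_
    · rw [e0, cutWord_replicate]
      exact (((hh b).toIsCut.iterate n).mono (hM1.trans (hend J hJ).le)).trans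
        (exitPos_spec hne _).1
    · rw [e0, ← cutWord_replicate]
      exact (hend J hJ).exitPos_cutWord_le hne hh hM (hend _ (hmap b J hJ)) (hlt b J hJ) _
  have hsub : ∀ {u : ℕ → ℕ} {c : ℝ} {k : ℕ}, 1 ≤ k →
      Tendsto (fun n : ℕ => Real.log (u n) / n) atTop (nhds c) →
      Tendsto (fun n : ℕ => Real.log (u (k * n)) / n) atTop (nhds (k * c)) := by
    intro u c k hk hu
    have h1 : Tendsto (fun n : ℕ => k * n) atTop atTop :=
      tendsto_id.const_mul_atTop' (by omega)
    refine ((hu.comp h1).const_mul (k : ℝ)).congr fun n => ?_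
    simp only [Function.comp, Nat.cast_mul]
    have : (k : ℝ) ≠ 0 := by positivity
    rcases eq_or_ne (n : ℝ) 0 with hn | hn
    · simp [hn]
    · field_simp
  have h1 := hsub hk (hlim true)
  have h2 := hsub hl (hlim false)
  refine hind k l (by omega) (by omega) (tendsto_nhds_unique h1 (h2.congr fun n => ?_))
  rw [heq n]

end Exit

/-! ### Short periods and repeated distances. -/

/-- The sequence of the words of length two of `x`. -/
def pairSeq {A : Type*} (x : ℕ → A) (i : ℕ) : A × A := (x i, x (i + 1))

section Periods

variable {A : Type*} {x : ℕ → A} {f g : ℕ → ℕ} {B : Set (A × A)} {N₀ : ℕ}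

theorem pairSeq_word {i j : ℕ} (h : pairSeq x i = pairSeq x j) :
    ∀ s < 2, x (i + s) = x (j + s) := by
  obtain ⟨h0, h1⟩ := Prod.ext_iff.1 h
  intro s hs
  interval_cases s
  · exact h0
  · exact h1

theorem IsLeafCut.leafMax_comp_le [Finite A] {x : ℕ → A} {B : Set A} (hf : IsLeafCut x B f)
    (hG : IsCut x g) {M : ℕ} (hM : ∀ i, f (i + 1) ≤ f i + M) (hB : ∃ i, x i ∈ B) :
    leafMax x B (g ∘ f) ≤ M * leafMax x B g := by
  obtain ⟨i, hi, him⟩ := (hG.comp hf.toIsCut).exists_leafMax hB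
  have := hf.comp_block_le hG hM (hf.sub i hi)
  simp only [Function.comp_apply] at him
  omega

theorem IsLeafCut.two_pow_le_leafMax [Finite A] {x : ℕ → A} {B : Set A} (hf : IsLeafCut x B f)
    (hB : ∃ i, x i ∈ B) (n : ℕ) : 2 ^ n ≤ leafMax x B f^[n] := by
  obtain ⟨i, hi⟩ := hB
  have h1 := hf.pow_le n i
  have h2 := (hf.toIsCut.iterate n).le_leafMax hi
  omega

/-- If `x` is not ultimately periodic, the words `σⁿ(cd)` have no short periods. -/
theorem exists_no_short_period [Finite A] (hx : ¬ IsUltimatelyPeriodic x)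
    {h : Bool → ℕ → ℕ} (hcut : ∀ b, IsCut x (h b)) (hh : ∀ b, IsLeafCut (pairSeq x) B (h b))
    (hN₀ : ∀ k, N₀ ≤ k → pairSeq x k ∈ B) :
    ∃ K, ∀ n i p, N₀ ≤ i → 0 < p → K * p ≤ leafMax (pairSeq x) B (h true)^[n] →
      ¬ ∀ s, (h true)^[n] i ≤ s → s + p < (h true)^[n] (i + 2) → x s = x (s + p) := by
  obtain ⟨M, hM1, hM⟩ := exists_common_bound hh
  have hB : ∃ i, pairSeq x i ∈ B := ⟨N₀, hN₀ N₀ le_rfl⟩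
  set f := h true
  have hf : IsLeafCut (pairSeq x) B f := hh true
  have hfx : IsCut x f := hcut true
  refine ⟨M * M + 1, fun n i p hi hp hKp hper => ?_⟩
  rcases n with _ | n
  · rw [Function.iterate_zero, leafMax_id hB] at hKp
    nlinarith
  have h1 := hf.leafMax_comp_le (hf.toIsCut.iterate n) (hM true) hB
  rw [← Function.iterate_succ] at h1
  -- The constant `M * M + 1` makes every `f^[n]`-block of the tail at least `p` long: one factor
  -- `M` passes from level `n + 1` to level `n`, the other from the largest block to an arbitrary
  -- one.
  have hpb : ∀ k, N₀ ≤ k → f^[n] k + p ≤ f^[n] (k + 1) := by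
    intro k hk
    have h2 := leafMax_le_mul_block hh hM1 hM (List.replicate n true) (hN₀ k hk)
    rw [cutWord_replicate] at h2
    have h3 := (hfx.iterate n).lt_succ k
    obtain ⟨d, hd⟩ : ∃ d, f^[n] (k + 1) = f^[n] k + d := ⟨f^[n] (k + 1) - f^[n] k, by omega⟩
    change leafMax _ _ f^[n] + M * f^[n] k ≤ M * f^[n] (k + 1) at h2
    rw [hd, mul_add] at h2
    rw [hd]
    have h4 : M * leafMax (pairSeq x) B f^[n] ≤ M * (M * d) := Nat.mul_le_mul_left _ (by omega)
    have h5 : M * M * p ≤ M * M * d := by nlinarith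
    have := Nat.le_of_mul_le_mul_left h5 (by positivity)
    omega
  refine hx ⟨f^[n] N₀, p, hp, fun j hj => ?_⟩
  obtain ⟨k, hk1, hk2⟩ := (hfx.iterate n).exists_block j
  have hkN : N₀ ≤ k := by
    have := (hfx.iterate n).strictMono.lt_iff_lt.1 (lt_of_le_of_lt hj hk2); omega
  -- The pair at `k` occurs in the image of the pair at `i`, so its `f^[n]`-image inherits the
  -- period. The second letter of the pair provides room to compare `j` with `j + p` across the
  -- block boundary.
  obtain ⟨s, t, hs1, hs2, hs3, hs4, -⟩ := hf.twice i (hN₀ i hi) _ (hN₀ k hkN)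
  have hword := pairSeq_word hs4
  have hlen := (hfx.iterate n).word_len hword
  have h2 := hpb (k + 1) (by omega)
  rw [show k + 1 + 1 = k + 2 by rfl] at h2
  have h3 := (hfx.iterate n).word_block hword (s := j - f^[n] k) (by omega)
  have h4 := (hfx.iterate n).word_block hword (s := j - f^[n] k + p) (by omega)
  have h5 : f^[n] (f i) ≤ f^[n] s := (hfx.iterate n).mono hs1
  have h6 : f^[n] (s + 2) ≤ f^[n] (f (i + 2)) := by
    refine (hfx.iterate n).mono ?_
    have := hfx.lt_succ (i + 1)
    rw [show i + 1 + 1 = i + 2 by rfl] at this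
    omega
  have h7 := hper (f^[n] s + (j - f^[n] k))
    (by rw [Function.iterate_succ_apply]; omega) (by rw [Function.iterate_succ_apply]; omega)
  rw [h3, add_assoc, h4] at h7
  rw [show f^[n] k + (j - f^[n] k) = j by omega,
    show f^[n] k + (j - f^[n] k + p) = j + p by omega] at h7
  exact h7.symm

/-- The start of the eventual part of `x` has bounded weight. -/
theorem IsLeafCut.iterate_le_mul [Finite A] {x : ℕ → A} {B : Set A} (hf : IsLeafCut x B f)
    (hN₀ : ∀ k, N₀ ≤ k → x k ∈ B) (n : ℕ) : f^[n] N₀ ≤ f N₀ * leafMax x B f^[n] := by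
  have hB : ∃ i, x i ∈ B := ⟨N₀, hN₀ N₀ le_rfl⟩
  induction n with
  | zero => rw [Function.iterate_zero, leafMax_id hB]; simpa using hf.le_apply N₀
  | succ n ih =>
    rw [Function.iterate_succ]
    have h1 := hf.two_mul_leafMax_le_comp (hf.toIsCut.iterate n) hB
    have h2 := (hf.toIsCut.iterate n).word_le_leafMax (B := B) (hf.le_apply N₀)
      fun s hs _ => hN₀ s hs
    simp only [Function.comp_apply]
    have h3 : (f N₀ - N₀) * leafMax x B f^[n] ≤ f N₀ * leafMax x B f^[n] :=
      Nat.mul_le_mul_right _ (Nat.sub_le _ _)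
    have h4 := Nat.mul_le_mul_left (f N₀) h1
    linarith

/-- If `x` is not ultimately periodic, then there are boundedly many distances, in a window
`[Θ, MΘ)`, between the images of two given occurrences of a word of length two. -/
theorem exists_distances_eq [Finite A] (hx : ¬ IsUltimatelyPeriodic x)
    {h : Bool → ℕ → ℕ} (hcut : ∀ b, IsCut x (h b)) (hh : ∀ b, IsLeafCut (pairSeq x) B (h b))
    (hN₀ : ∀ k, N₀ ≤ k → pairSeq x k ∈ B) {i j : ℕ} (hi : N₀ + h true N₀ ≤ i) (hij : i < j)
    (hpair : pairSeq x i = pairSeq x j) (R : ℕ) :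
    ∃ N Θ₀, ∀ Θ, Θ₀ ≤ Θ → ∀ S : Finset (List Bool),
      (∀ w ∈ S, cutWord h w i + Θ ≤ cutWord h w j ∧ cutWord h w j < cutWord h w i + R * Θ) →
      N < S.card → ∃ w ∈ S, ∃ w' ∈ S, w ≠ w' ∧
        cutWord h w j + cutWord h w' i = cutWord h w' j + cutWord h w i := by
  classical
  obtain ⟨K, hK⟩ := exists_no_short_period hx hcut hh hN₀
  obtain ⟨M, hM1, hM⟩ := exists_common_bound hh
  have hB : ∃ i, pairSeq x i ∈ B := ⟨N₀, hN₀ N₀ le_rfl⟩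
  have hcutw : ∀ w, IsCut x (cutWord h w) := by
    intro w
    induction w with
    | nil => exact IsCut.id x
    | cons b w ih => exact (hcut b).comp ih
  have hiter : ∀ n, cutWord h (List.replicate n true) = (h true)^[n] := cutWord_replicate h true
  set f := h true
  have hf : IsLeafCut (pairSeq x) B f := hh true
  have hfx : IsCut x f := hcut true
  set m := leafMax (pairSeq x) B with hm
  set D := j - i with hD
  have hD1 : 1 ≤ D := by omega
  -- Scale-`q` blocks have length between `μ / M` and `μ`, so `E` of them cover an admissible
  -- distance plus two blocks. Below, `Q` bounds such a distance measured in units of `μ / K`.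
  set E := M * (R * (3 * D * M * M) + 2) with hE
  set Q := R * (3 * D * M * M) * K with hQ
  have := Fintype.ofFinite A
  refine ⟨Fintype.card ((Fin E → A) × Fin (Q + 1)), 3 * D * M, fun Θ hΘ S hS hcard => ?_⟩
  -- the scale
  obtain ⟨q, hq1, hq2⟩ : ∃ q, 3 * D * M * m f^[q] ≤ Θ ∧ Θ < 3 * D * M * m f^[q + 1] := by
    have hex : ∃ q, Θ < 3 * D * M * m f^[q + 1] := by
      refine ⟨Θ, ?_⟩
      have h1 : 2 ^ (Θ + 1) ≤ m f^[Θ + 1] := hf.two_pow_le_leafMax hB (Θ + 1)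
      have h2 := Nat.lt_two_pow_self (n := Θ + 1)
      have h3 : 1 ≤ 3 * D * M := by nlinarith
      nlinarith
    refine ⟨Nat.find hex, ?_, Nat.find_spec hex⟩
    rcases h0 : Nat.find hex with _ | q
    · rw [Function.iterate_zero, hm, leafMax_id hB]; omega
    · exact not_lt.1 (Nat.find_min hex (m := q) (by omega))
  set μ := m f^[q] with hμ
  have hμ1 : 1 ≤ μ := Nat.one_le_two_pow.trans (hf.two_pow_le_leafMax hB q)
  have hq3 : Θ ≤ 3 * D * M * M * μ := by
    have h1 := hf.leafMax_comp_le (hf.toIsCut.iterate q) (hM true) hB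
    rw [← Function.iterate_succ] at h1
    calc Θ ≤ 3 * D * M * m f^[q + 1] := hq2.le
      _ ≤ 3 * D * M * (M * μ) := Nat.mul_le_mul_left _ h1
      _ = _ := by ring
  have hblock : ∀ w k, N₀ ≤ k → m (cutWord h w) + M * cutWord h w k ≤ M * cutWord h w (k + 1) :=
    fun w k hk => leafMax_le_mul_block hh hM1 hM w (hN₀ k hk)
  have hle : ∀ w k, N₀ ≤ k → cutWord h w (k + 1) ≤ cutWord h w k + m (cutWord h w) :=
    fun w k hk => (isCut_cutWord hh w).le_leafMax (hN₀ k hk)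
  -- an aligned block of scale `q` that repeats at the given distance
  have hal : ∀ w ∈ S, ∃ k, N₀ ≤ k ∧ ∀ r, f^[q] k + r < f^[q] (k + 2) →
      x (f^[q] k + r) = x (f^[q] k + r + (cutWord h w j - cutWord h w i)) := by
    intro w hw
    obtain ⟨hw1, hw2⟩ := hS w hw
    set F := cutWord h w
    have hFx : IsCut x F := hcutw w
    have h1 : F j ≤ F i + D * m F := by
      have := IsCut.sub_le_mul (G := F) (D := m F) (fun k hk _ => hle w k (by omega)) hij.le
      exact this
    have h2 : 3 * M * μ ≤ m F := by
      have : D * (3 * M * μ) ≤ D * m F := by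
        calc D * (3 * M * μ) = 3 * D * M * μ := by ring
          _ ≤ Θ := hq1
          _ ≤ D * m F := by omega
      exact Nat.le_of_mul_le_mul_left this hD1
    -- A block of length `3 * μ` has room for the rest of the scale-`q` block containing its start
    -- and for two more complete ones. This is the origin of the factor 3 in the scale.
    have hbl : ∀ k, N₀ ≤ k → F k + 3 * μ ≤ F (k + 1) := by
      intro k hk
      have h3 : m F + M * F k ≤ M * F (k + 1) := hblock w k hk
      have h4 : M * (F k + 3 * μ) ≤ M * F (k + 1) := by
        rw [mul_add]
        have : M * (3 * μ) = 3 * M * μ := by ring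
        omega
      exact Nat.le_of_mul_le_mul_left h4 hM1
    -- The hypothesis that `i` lies beyond `N₀ + f N₀` ensures that the aligned blocks belong to the
    -- part of the sequence over `B`.
    have h3 : f^[q] N₀ ≤ F i := by
      have h4 := hf.iterate_le_mul hN₀ q
      have h5 := IsCut.mul_le_sub (G := F) (i := N₀) (j := i) (fun k hk _ => hbl k hk) (by omega)
      have h6 : f N₀ * μ ≤ (i - N₀) * (3 * μ) := Nat.mul_le_mul (by omega) (by omega)
      change f^[q] N₀ ≤ f N₀ * μ at h4
      omega
    obtain ⟨k, hk1, hk2⟩ := (hfx.iterate q).exists_block (F i)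
    have hkN : N₀ ≤ k := by
      have := (hfx.iterate q).strictMono.lt_iff_lt.1 (lt_of_le_of_lt h3 hk2); omega
    have hleq : ∀ k, N₀ ≤ k → f^[q] (k + 1) ≤ f^[q] k + μ := fun k hk =>
      (hf.toIsCut.iterate q).le_leafMax (hN₀ k hk)
    have h4 := hleq k hkN
    have h5 := hleq (k + 1) (by omega)
    have h6 := hleq (k + 2) (by omega)
    have h7 := hbl i (by omega)
    refine ⟨k + 1, by omega, fun r hr => ?_⟩
    rw [show k + 1 + 2 = k + 2 + 1 by rfl] at hr
    rw [show k + 1 + 1 = k + 2 by rfl] at h5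
    have h8 := hFx.block i j (Prod.ext_iff.1 hpair).1 (f^[q] (k + 1) + r - F i) (by omega)
    rw [show F i + (f^[q] (k + 1) + r - F i) = f^[q] (k + 1) + r by omega] at h8
    rw [h8]
    congr 1
    omega
  choose! k hkN hk using hal
  have hmap : ∀ w ∈ S, (cutWord h w j - cutWord h w i) * K / μ < Q + 1 := by
    intro w hw
    obtain ⟨hw1, hw2⟩ := hS w hw
    rw [Nat.lt_succ_iff]
    refine Nat.div_le_of_le_mul ?_
    calc (cutWord h w j - cutWord h w i) * K ≤ (R * (3 * D * M * M * μ)) * K := by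
          refine Nat.mul_le_mul_right _ (le_trans ?_ (Nat.mul_le_mul_left R hq3))
          omega
      _ = μ * Q := by rw [hQ]; ring
  let data : List Bool → (Fin E → A) × Fin (Q + 1) := fun w =>
    (fun e => x (k w + e), Fin.ofNat (Q + 1) ((cutWord h w j - cutWord h w i) * K / μ))
  obtain ⟨w, hw, w', hw', hne, hdata⟩ := Finset.exists_ne_map_eq_of_card_lt_of_maps_to
    (t := Finset.univ) (f := data) (s := S) (by simpa using hcard) (fun _ _ => Finset.mem_univ _)
  refine ⟨w, hw, w', hw', hne, ?_⟩
  obtain ⟨hd1, hd2⟩ := Prod.ext_iff.1 hdata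
  have hword : ∀ s < E, x (k w + s) = x (k w' + s) := fun s hs => congrFun hd1 ⟨s, hs⟩
  have hcell : (cutWord h w j - cutWord h w i) * K / μ =
      (cutWord h w' j - cutWord h w' i) * K / μ := by
    have := congrArg Fin.val hd2
    simp only [data, Fin.ofNat] at this
    rwa [Nat.mod_eq_of_lt (hmap w hw), Nat.mod_eq_of_lt (hmap w' hw')] at this
  -- Equal data mean the same image word, in which an aligned pair recurs at the offsets `t` and
  -- `t'` with `K * (t' - t) ≤ μ`. If `t < t'`, then `t' - t` is a forbidden short period of that
  -- pair.
  have main : ∀ w ∈ S, ∀ w' ∈ S, (∀ s < E, x (k w + s) = x (k w' + s)) →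
      (cutWord h w j - cutWord h w i) * K / μ = (cutWord h w' j - cutWord h w' i) * K / μ →
      ¬ (cutWord h w j - cutWord h w i < cutWord h w' j - cutWord h w' i) := by
    intro w hw w' hw' hword hcell hlt
    set t := cutWord h w j - cutWord h w i with ht
    set t' := cutWord h w' j - cutWord h w' i with ht'
    have hp : K * (t' - t) ≤ μ := by
      have h1 := Nat.lt_mul_div_succ (t' * K) hμ1
      have h2 := Nat.mul_div_le (t * K) μ
      rw [← hcell, mul_add] at h1
      have h3 : K * (t' - t) + t * K = t' * K := by
        rw [mul_comm K, ← add_mul]; congr 1; omega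
      omega
    refine hK q (k w) (t' - t) (hkN w hw) (by omega) hp fun s hs1 hs2 => ?_
    change f^[q] (k w) ≤ s at hs1
    change s + (t' - t) < f^[q] (k w + 2) at hs2
    obtain ⟨r, rfl⟩ : ∃ r, s = f^[q] (k w) + r := ⟨s - f^[q] (k w), by omega⟩
    have hE2 : 2 ≤ E := Nat.mul_le_mul hM1 (Nat.le_add_left 2 (R * (3 * D * M * M)))
    have hlen := (hfx.iterate q).word_len (ℓ := 2) fun s hs => hword s (by omega)
    have hlong : f^[q] (k w) + (r + t') < f^[q] (k w + E) := by
      obtain ⟨hS1, hS2⟩ := hS w' hw'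
      have h1 : t' ≤ R * (3 * D * M * M * μ) :=
        le_trans (by omega) (Nat.mul_le_mul_left R hq3)
      have hleq : ∀ k, N₀ ≤ k → f^[q] (k + 1) ≤ f^[q] k + μ := fun k hk =>
        (hf.toIsCut.iterate q).le_leafMax (hN₀ k hk)
      have h2 := hleq (k w) (hkN w hw)
      have h3 := hleq (k w + 1) (by have := hkN w hw; omega)
      rw [show k w + 1 + 1 = k w + 2 by rfl] at h3
      have h4 : ∀ c, N₀ ≤ c → M * f^[q] c + μ ≤ M * f^[q] (c + 1) := by
        intro c hc
        have := hblock (List.replicate q true) c hc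
        rw [hiter] at this
        change μ + M * f^[q] c ≤ _ at this
        omega
      have h5 := IsCut.mul_le_sub (G := fun c => M * f^[q] c) (i := k w) (j := k w + E)
        (fun c hc _ => h4 c (by have := hkN w hw; omega)) (by omega)
      rw [show k w + E - k w = E by omega] at h5
      have h6 : E * μ = M * (R * (3 * D * M * M * μ) + 2 * μ) := by rw [hE]; ring
      rw [h6, ← mul_add] at h5
      have h7 := Nat.le_of_mul_le_mul_left h5 hM1
      omega
    have e1 := hk w hw (r + (t' - t)) (by omega)
    have e2 := hk w' hw' r (by omega)
    have e3 := (hfx.iterate q).word_block hword (s := r) (by omega)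
    have e4 := (hfx.iterate q).word_block hword (s := r + t') hlong
    rw [← ht, show f^[q] (k w) + (r + (t' - t)) + t = f^[q] (k w) + (r + t') by omega] at e1
    rw [← ht', add_assoc] at e2
    rw [add_assoc, e1, e4, ← e2, e3]
  have h1 := main w hw w' hw' hword hcell
  have h2 := main w' hw' w hw (fun s hs => (hword s hs).symm) hcell.symm
  have h3 := (hcutw w).mono hij.le
  have h4 := (hcutw w').mono hij.le
  omega

end Periods

/-! ### Perron–Frobenius for positive matrices. -/

section PerronFrobenius

variable {ι : Type*} [Fintype ι]

/-- A weighted mean whose weights are all at least `η` lies `η` times the oscillation below the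
upper bound of its terms. -/
theorem weighted_mean_le {w r : ι → ℝ} {η hi : ℝ} (hw : ∀ d, η ≤ w d) (hη : 0 ≤ η)
    (hsum : ∑ d, w d = 1) (hr : ∀ d, r d ≤ hi) (d₀ : ι) :
    ∑ d, w d * r d ≤ hi - η * (hi - r d₀) := by
  have h1 : ∑ d, w d * (hi - r d) = hi - ∑ d, w d * r d := by
    simp only [mul_sub, Finset.sum_sub_distrib, ← Finset.sum_mul, hsum, one_mul]
  have h2 : w d₀ * (hi - r d₀) ≤ ∑ d, w d * (hi - r d) :=
    Finset.single_le_sum (f := fun d => w d * (hi - r d))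
      (fun d _ => mul_nonneg (hη.trans (hw d)) (sub_nonneg.2 (hr d))) (Finset.mem_univ d₀)
  have h3 : η * (hi - r d₀) ≤ w d₀ * (hi - r d₀) :=
    mul_le_mul_of_nonneg_right (hw d₀) (sub_nonneg.2 (hr d₀))
  linarith

/-- Iterated weighted means with weights bounded below converge to a constant. -/
theorem exists_tendsto_of_weighted_mean [Nonempty ι] {R : ℕ → ι → ℝ} {η : ℝ} (hη : 0 < η)
    (hR : ∀ n b, ∃ w : ι → ℝ, (∀ d, η ≤ w d) ∧ ∑ d, w d = 1 ∧ R (n + 1) b = ∑ d, w d * R n d) :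
    ∃ ρ, ∀ b, Tendsto (fun n => R n b) atTop (nhds ρ) := by
  have hmax : ∀ n, ∃ d, ∀ b, R n b ≤ R n d := fun n => Finite.exists_max (R n)
  have hmin : ∀ n, ∃ d, ∀ b, R n d ≤ R n b := fun n => Finite.exists_min (R n)
  choose D hD using hmax
  choose d hd using hmin
  have hup : ∀ n b, R (n + 1) b ≤ R n (D n) - η * (R n (D n) - R n (d n)) := by
    intro n b
    obtain ⟨w, hw1, hw2, hw3⟩ := hR n b
    rw [hw3]
    exact weighted_mean_le hw1 hη.le hw2 (hD n) (d n)
  have hlo : ∀ n b, R n (d n) ≤ R (n + 1) b := by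
    intro n b
    obtain ⟨w, hw1, hw2, hw3⟩ := hR n b
    rw [hw3, ← one_mul (R n (d n)), ← hw2, Finset.sum_mul]
    exact Finset.sum_le_sum fun e _ => mul_le_mul_of_nonneg_left (hd n e) (hη.le.trans (hw1 e))
  have hosc0 : ∀ n, 0 ≤ R n (D n) - R n (d n) := fun n => sub_nonneg.2 (hd n _)
  have hη1 : η ≤ 1 := by
    obtain ⟨b⟩ := ‹Nonempty ι›
    obtain ⟨w, hw1, hw2, -⟩ := hR 0 b
    rw [← hw2]
    exact (hw1 b).trans (Finset.single_le_sum (fun e _ => hη.le.trans (hw1 e)) (Finset.mem_univ b))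
  -- Averaging with weights at least `η` contracts the oscillation by the factor `1 - η`.
  have hosc : ∀ n, R n (D n) - R n (d n) ≤ (1 - η) ^ n * (R 0 (D 0) - R 0 (d 0)) := by
    intro n
    induction n with
    | zero => simp
    | succ n ih =>
      have h1 := hup n (D (n + 1))
      have h2 := hlo n (d (n + 1))
      have h3 := mul_le_mul_of_nonneg_left ih (sub_nonneg.2 hη1)
      rw [pow_succ]
      linarith
  have hosclim : Tendsto (fun n => R n (D n) - R n (d n)) atTop (nhds 0) := by
    have h1 := (tendsto_pow_atTop_nhds_zero_of_lt_one (sub_nonneg.2 hη1)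
      (by linarith : 1 - η < 1)).mul_const (R 0 (D 0) - R 0 (d 0))
    rw [zero_mul] at h1
    exact squeeze_zero hosc0 hosc h1
  have hmono : Monotone fun n => R n (d n) := monotone_nat_of_le_succ fun n => hlo n _
  have hanti : Antitone fun n => R n (D n) := antitone_nat_of_succ_le fun n => by
    have := hup n (D (n + 1))
    have := mul_nonneg hη.le (hosc0 n)
    linarith
  have hbdd : BddBelow (Set.range fun n => R n (D n)) := by
    refine ⟨R 0 (d 0), ?_⟩
    rintro _ ⟨n, rfl⟩
    exact (hmono (Nat.zero_le n)).trans (hd n _)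
  have hlim := tendsto_atTop_ciInf hanti hbdd
  have hlim2 := hlim.sub hosclim
  simp only [sub_sub_cancel, sub_zero] at hlim2
  exact ⟨_, fun b => tendsto_of_tendsto_of_tendsto_of_le_of_le hlim2 hlim
    (fun n => hd n b) fun n => hD n b⟩

variable [DecidableEq ι]

theorem matrix_pow_pos {M : Matrix ι ι ℝ} (hM : ∀ c b, 0 < M c b) {n : ℕ} (hn : 1 ≤ n) (c b : ι) :
    0 < (M ^ n) c b := by
  induction n, hn using Nat.le_induction generalizing c b with
  | base => simpa using hM c b
  | succ n hn ih =>
    rw [pow_succ, Matrix.mul_apply]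
    exact Finset.sum_pos (fun d _ => mul_pos (ih c d) (hM d b)) ⟨b, Finset.mem_univ b⟩

/-- The ratio at `b` for the next power is a weighted mean of the present ratios at all `d`, with
weights `(M ^ n) c d * M d b / (M ^ (n + 1)) c b`. Comparing with the row sum of the preceding power
bounds the weights below. Starting at exponent 2 makes that power positive. -/
theorem exists_tendsto_row_ratio [Nonempty ι] {M : Matrix ι ι ℝ} (hM : ∀ c b, 0 < M c b) (c : ι) :
    ∃ ρ, ∀ b, Tendsto (fun n => (M ^ (n + 1)) c b / (M ^ n) c b) atTop (nhds ρ) := by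
  obtain ⟨p, hp⟩ := Finite.exists_max fun q : ι × ι => M q.1 q.2
  obtain ⟨q, hq⟩ := Finite.exists_min fun q : ι × ι => M q.1 q.2
  set X := M p.1 p.2
  set Y := M q.1 q.2
  have hX : 0 < X := hM _ _
  have hY : 0 < Y := hM _ _
  have hle : ∀ a b, M a b ≤ X := fun a b => hp (a, b)
  have hge : ∀ a b, Y ≤ M a b := fun a b => hq (a, b)
  set k : ℝ := (Fintype.card ι : ℝ)
  have hk : 0 < k := by
    have : 0 < Fintype.card ι := Fintype.card_pos
    positivity
  have key : ∃ ρ, ∀ b, Tendsto (fun n => (M ^ (n + 2 + 1)) c b / (M ^ (n + 2)) c b) atTop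
      (nhds ρ) := by
    refine exists_tendsto_of_weighted_mean (η := Y * Y / (k * X * X)) (by positivity)
      fun n b => ?_
    have hpos : ∀ n, 1 ≤ n → ∀ d, 0 < (M ^ n) c d := fun n hn d => matrix_pow_pos hM hn c d
    have hstep : ∀ n b, (M ^ (n + 1)) c b = ∑ d, (M ^ n) c d * M d b := fun n b => by
      rw [pow_succ, Matrix.mul_apply]
    refine ⟨fun d => (M ^ (n + 2)) c d * M d b / (M ^ (n + 2 + 1)) c b, fun d => ?_, ?_, ?_⟩
    · set S := ∑ e, (M ^ (n + 1)) c e with hS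
      have hSpos : 0 < S := Finset.sum_pos (fun e _ => hpos _ (by omega) e) Finset.univ_nonempty
      have h1 : ∀ e, (M ^ (n + 2)) c e ≤ S * X := fun e => by
        rw [hstep, hS, Finset.sum_mul]
        exact Finset.sum_le_sum fun a _ =>
          mul_le_mul_of_nonneg_left (hle a e) (hpos _ (by omega) a).le
      have h2 : S * Y ≤ (M ^ (n + 2)) c d := by
        rw [hstep, hS, Finset.sum_mul]
        exact Finset.sum_le_sum fun a _ =>
          mul_le_mul_of_nonneg_left (hge a d) (hpos _ (by omega) a).le
      have h3 : (M ^ (n + 2 + 1)) c b ≤ k * (S * X * X) := by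
        rw [hstep]
        refine (Finset.sum_le_card_nsmul _ _ (S * X * X) fun e _ => ?_).trans (by simp [k])
        exact mul_le_mul (h1 e) (hle e b) (hM e b).le (by positivity)
      rw [div_le_div_iff₀ (by positivity) (hpos _ (by omega) b)]
      calc Y * Y * (M ^ (n + 2 + 1)) c b ≤ Y * Y * (k * (S * X * X)) := by gcongr
        _ = S * Y * Y * (k * X * X) := by ring
        _ ≤ (M ^ (n + 2)) c d * M d b * (k * X * X) := by
          gcongr
          · exact (hpos _ (by omega) d).le
          · exact hge d b
    · rw [← Finset.sum_div, ← hstep]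
      exact div_self (hpos _ (by omega) b).ne'
    · rw [hstep (n + 1 + 2), Finset.sum_div]
      refine Finset.sum_congr rfl fun d _ => ?_
      have e1 := (hpos (n + 2) (by omega) d).ne'
      rw [show n + 1 + 2 = n + 2 + 1 by ring]
      field_simp
  obtain ⟨ρ, hρ⟩ := key
  exact ⟨ρ, fun b => (tendsto_add_atTop_iff_nat 2).1 (hρ b)⟩

/-- The entries of the powers of a positive matrix grow geometrically, all at the same rate. -/
theorem exists_tendsto_pow_ratio [Nonempty ι] {M : Matrix ι ι ℝ} (hM : ∀ c b, 0 < M c b) :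
    ∃ ρ, ∀ c b, Tendsto (fun n => (M ^ (n + 1)) c b / (M ^ n) c b) atTop (nhds ρ) := by
  choose r hr using exists_tendsto_row_ratio hM
  choose s hs using exists_tendsto_row_ratio (M := M.transpose) fun c b => hM b c
  -- The same ratio of entries serves row `c` of `M` and row `b` of its transpose, so all row and
  -- column limits coincide.
  have hrs : ∀ c b, r c = s b := by
    intro c b
    refine tendsto_nhds_unique (hr c b) ((hs b c).congr fun n => ?_)
    rw [← Matrix.transpose_pow, ← Matrix.transpose_pow, Matrix.transpose_apply,
      Matrix.transpose_apply]
  obtain ⟨i⟩ := ‹Nonempty ι›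
  refine ⟨s i, fun c b => ?_⟩
  rw [← hrs c i]
  exact hr c b

end PerronFrobenius

/-! ### Letter counts, growth rates and growth exponents. -/

section Counting

variable {A : Type*} {x : ℕ → A} {B : Set A} {f g : ℕ → ℕ} {N₀ : ℕ}

open scoped Classical in
/-- The numbers of occurrences of the letters of `B` in the word `x[i, j)`. -/
noncomputable def letterCount (x : ℕ → A) (B : Set A) (i j : ℕ) (c : B) : ℝ :=
  ((Finset.Ico i j).filter (x · = c)).card

open scoped Classical in
theorem letterCount_add {i j k : ℕ} (hij : i ≤ j) (hjk : j ≤ k) (c : B) :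
    letterCount x B i k c = letterCount x B i j c + letterCount x B j k c := by
  unfold letterCount
  rw [← Finset.Ico_union_Ico_eq_Ico hij hjk, Finset.filter_union, Finset.card_union_of_disjoint]
  · push_cast; rfl
  · exact Finset.disjoint_filter_filter (Finset.Ico_disjoint_Ico_consecutive i j k)

open scoped Classical in
theorem letterCount_self (i : ℕ) (c : B) : letterCount x B i i c = 0 := by
  simp [letterCount]

open scoped Classical in
theorem letterCount_succ (i : ℕ) (c : B) :
    letterCount x B i (i + 1) c = if x i = c then 1 else 0 := by
  unfold letterCount
  rw [Nat.Ico_succ_singleton, Finset.filter_singleton]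
  split_ifs <;> simp

theorem letterCount_nonneg (i j : ℕ) (c : B) : 0 ≤ letterCount x B i j c := by
  unfold letterCount; positivity

open scoped Classical in
theorem letterCount_block_le (hf : IsCut x f) {i j : ℕ} (hij : x i = x j) (c : B) :
    letterCount x B (f i) (f (i + 1)) c ≤ letterCount x B (f j) (f (j + 1)) c := by
  unfold letterCount
  have h0 := hf.len i j hij
  have h1 := hf.lt_succ i
  refine Nat.cast_le.2 (Finset.card_le_card_of_injOn (fun s => f j + (s - f i)) ?_ ?_)
  · intro s hs
    simp only [Finset.coe_filter, Finset.mem_Ico, Set.mem_ofPred_eq] at hs ⊢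
    have h2 := hf.block i j hij (s - f i) (by omega)
    rw [show f i + (s - f i) = s by omega] at h2
    exact ⟨by omega, h2 ▸ hs.2⟩
  · intro s hs t ht hst
    simp only [Finset.coe_filter, Finset.mem_Ico, Set.mem_ofPred_eq] at hs ht hst
    omega

variable [Fintype B]

/-- An additive function of words is determined by its values on letters. -/
theorem additive_eq_sum_letterCount {φ : ℕ → ℝ} {v : B → ℝ} {i j : ℕ} (hij : i ≤ j)
    (hB : ∀ s, i ≤ s → s < j → x s ∈ B)
    (hφ : ∀ s (h : x s ∈ B), φ (s + 1) = φ s + v ⟨x s, h⟩) :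
    φ j - φ i = ∑ c, v c * letterCount x B i j c := by
  classical
  induction j, hij using Nat.le_induction with
  | base => simp [letterCount_self]
  | succ j hij ih =>
    have h1 := ih fun s hs hs' => hB s hs (by omega)
    have hj := hB j hij (by omega)
    have h2 : ∀ c : B, letterCount x B j (j + 1) c = if c = ⟨x j, hj⟩ then 1 else 0 := by
      intro c
      rw [letterCount_succ]
      congr 1
      rw [Subtype.ext_iff]
      exact propext ⟨Eq.symm, Eq.symm⟩
    simp only [letterCount_add hij (Nat.le_succ j), mul_add, Finset.sum_add_distrib, ← h1,
      Nat.succ_eq_add_one, h2]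
    simp only [mul_ite, mul_one, mul_zero, Finset.sum_ite_eq', Finset.mem_univ, if_true]
    rw [hφ j hj]
    ring

theorem exists_cutMatrix (hf : IsLeafCut x B f) (hB : ∀ b ∈ B, ∃ k, x k = b) :
    ∃ M : Matrix B B ℝ, (∀ c b, 0 < M c b) ∧ ∀ i j, i ≤ j → (∀ s, i ≤ s → s < j → x s ∈ B) →
      letterCount x B (f i) (f j) = M.mulVec (letterCount x B i j) := by
  classical
  choose k hk using fun b : B => hB b b.2
  refine ⟨Matrix.of fun c b => letterCount x B (f (k b)) (f (k b + 1)) c, fun c b => ?_, ?_⟩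
  · have hkb : x (k b) ∈ B := by rw [hk b]; exact b.2
    obtain ⟨s, t, h1, h2, h3, h4, h5⟩ := hf.twice (k b) hkb c c.2
    simp only [Matrix.of_apply, letterCount, Nat.cast_pos]
    exact Finset.card_pos.2 ⟨s, Finset.mem_filter.2 ⟨Finset.mem_Ico.2 ⟨h1, by omega⟩, h4⟩⟩
  · intro i j hij hs
    funext c
    have h1 := additive_eq_sum_letterCount (φ := fun s => letterCount x B 0 (f s) c)
      (v := fun b => letterCount x B (f (k b)) (f (k b + 1)) c) hij hs fun s hs => by
        rw [letterCount_add (Nat.zero_le _) (hf.mono (Nat.le_succ s))]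
        congr 1
        exact le_antisymm (letterCount_block_le hf.toIsCut (hk ⟨x s, hs⟩).symm c)
          (letterCount_block_le hf.toIsCut (hk ⟨x s, hs⟩) c)
    rw [letterCount_add (Nat.zero_le _) (hf.mono hij), add_sub_cancel_left] at h1
    rw [h1]
    rfl

/-- The lengths of the images of a word under the iterates of a cut grow geometrically, uniformly
over the words and over further images. -/
theorem exists_growth_rate (hf : IsLeafCut x B f) (hN₀ : ∀ k, N₀ ≤ k → x k ∈ B) :
    ∃ ρ : ℝ, ∀ ε, 0 < ε → ∃ n₀, ∀ n, n₀ ≤ n → ∀ G, IsCut x G → ∀ i j, N₀ ≤ i → i ≤ j →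
      |((G (f^[n + 1] j) : ℝ) - G (f^[n + 1] i)) - ρ * (G (f^[n] j) - G (f^[n] i))|
        ≤ ε * (G (f^[n] j) - G (f^[n] i)) := by
  classical
  have hBne : Nonempty B := ⟨⟨_, hN₀ N₀ le_rfl⟩⟩
  have hB : ∀ b ∈ B, ∃ k, x k = b := fun b hb => by
    obtain ⟨s, -, -, -, -, h4, -⟩ := hf.twice N₀ (hN₀ N₀ le_rfl) b hb
    exact ⟨s, h4⟩
  obtain ⟨M, hM, hcount⟩ := exists_cutMatrix hf hB
  obtain ⟨ρ, hρ⟩ := exists_tendsto_pow_ratio hM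
  refine ⟨ρ, fun ε hε => ?_⟩
  have hev : ∀ᶠ n in atTop, ∀ c b, |(M ^ (n + 1)) c b - ρ * (M ^ n) c b| ≤ ε * (M ^ n) c b := by
    refine eventually_all.2 fun c => eventually_all.2 fun b => ?_
    filter_upwards [(hρ c b).eventually (Metric.ball_mem_nhds ρ hε), eventually_ge_atTop 1]
      with n hn hn1
    have hpos := matrix_pow_pos hM hn1 c b
    change |_ - _| < _ at hn
    have h1 : (M ^ (n + 1)) c b - ρ * (M ^ n) c b =
        ((M ^ (n + 1)) c b / (M ^ n) c b - ρ) * (M ^ n) c b := by field_simp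
    rw [h1, abs_mul, abs_of_pos hpos]
    exact mul_le_mul_of_nonneg_right hn.le hpos.le
  obtain ⟨n₀, hn₀⟩ := eventually_atTop.1 hev
  refine ⟨n₀, fun n hn G hG i j hi hij => ?_⟩
  choose k hk using fun b : B => hB b b.2
  set v : B → ℝ := fun b => (G (k b + 1) : ℝ) - G (k b) with hv
  have hv0 : ∀ b, 0 ≤ v b := fun b => by
    have : (G (k b) : ℝ) ≤ G (k b + 1) := by exact_mod_cast (hG.lt_succ (k b)).le
    exact sub_nonneg.2 this
  have hlen : ∀ i j, N₀ ≤ i → i ≤ j → (G j : ℝ) - G i = ∑ c, v c * letterCount x B i j c := by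
    intro i j hi hij
    refine additive_eq_sum_letterCount (φ := fun s => (G s : ℝ)) hij
      (fun s hs _ => hN₀ s (hi.trans hs)) fun s hs => ?_
    have h1 : ((G (s + 1) : ℝ) + G (k ⟨x s, hs⟩)) = G (k ⟨x s, hs⟩ + 1) + G s := by
      exact_mod_cast hG.len s (k ⟨x s, hs⟩) (hk ⟨x s, hs⟩).symm
    simp only [hv]
    linarith
  have hpow : ∀ n, letterCount x B (f^[n] i) (f^[n] j) = (M ^ n).mulVec (letterCount x B i j) := by
    intro n
    induction n with
    | zero => simp
    | succ n ih =>
      rw [Function.iterate_succ_apply', Function.iterate_succ_apply', hcount _ _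
        ((hf.toIsCut.iterate n).mono hij) fun s hs _ =>
          hN₀ s (hi.trans (((hf.toIsCut.iterate n).le_apply i).trans hs)), ih, pow_succ',
        Matrix.mulVec_mulVec]
  -- Lengths are combinations of the entries of `M ^ n` with nonnegative coefficients. The entrywise
  -- estimate therefore carries over with the same `n₀` for all `G`, `i` and `j`.
  have hlenpow : ∀ n, (G (f^[n] j) : ℝ) - G (f^[n] i) =
      ∑ c, ∑ b, v c * (M ^ n) c b * letterCount x B i j b := by
    intro n
    rw [hlen _ _ (hi.trans ((hf.toIsCut.iterate n).le_apply i)) ((hf.toIsCut.iterate n).mono hij),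
      hpow]
    refine Finset.sum_congr rfl fun c _ => ?_
    simp only [Matrix.mulVec, dotProduct, Finset.mul_sum, mul_assoc]
  rw [hlenpow, hlenpow]
  simp only [Finset.mul_sum, ← Finset.sum_sub_distrib]
  refine (Finset.abs_sum_le_sum_abs _ _).trans (Finset.sum_le_sum fun c _ => ?_)
  refine (Finset.abs_sum_le_sum_abs _ _).trans (Finset.sum_le_sum fun b _ => ?_)
  have h1 := hn₀ n hn c b
  have h2 : 0 ≤ v c * letterCount x B i j b := mul_nonneg (hv0 c) (letterCount_nonneg i j b)
  rw [show v c * (M ^ (n + 1)) c b * letterCount x B i j b -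
      ρ * (v c * (M ^ n) c b * letterCount x B i j b) =
      ((M ^ (n + 1)) c b - ρ * (M ^ n) c b) * (v c * letterCount x B i j b) by ring, abs_mul,
    abs_of_nonneg h2]
  calc _ ≤ ε * (M ^ n) c b * (v c * letterCount x B i j b) := by gcongr
    _ = _ := by ring

end Counting

section Rate

variable {A : Type*} {x : ℕ → A} {B : Set A} {f : ℕ → ℕ} {N₀ : ℕ} {a ρ : ℝ}

theorem tendsto_log_div_of_ratio {s : ℕ → ℝ} (hs : ∀ n, 0 < s n) (hρ : 0 < ρ)
    (h : Tendsto (fun n => s (n + 1) / s n) atTop (nhds ρ)) :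
    Tendsto (fun n : ℕ => Real.log (s n) / n) atTop (nhds (Real.log ρ)) := by
  have h1 : Tendsto (fun n => Real.log (s (n + 1)) - Real.log (s n)) atTop
      (nhds (Real.log ρ)) := by
    refine (h.log hρ.ne').congr fun n => ?_
    rw [Real.log_div (hs _).ne' (hs _).ne']
  have h2 := h1.cesaro
  have h3 : Tendsto (fun n : ℕ => Real.log (s 0) / n) atTop (nhds 0) :=
    tendsto_const_div_atTop_nhds_zero_nat _
  have h4 := h2.add h3
  rw [add_zero] at h4
  refine h4.congr fun n => ?_
  rw [Finset.sum_range_sub (fun n => Real.log (s n))]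
  ring

/-- The growth rate on the eventual alphabet is given by the growth exponent. -/
theorem growth_rate_eq_exp [Finite A] (hf : IsLeafCut x B f) (hN₀ : ∀ k, N₀ ≤ k → x k ∈ B)
    (hN₁ : 1 ≤ N₀) (ha : HasGrowthExponent f a)
    (h : ∀ ε, 0 < ε → ∃ n₀, ∀ n, n₀ ≤ n → ∀ G, IsCut x G → ∀ i j, N₀ ≤ i → i ≤ j →
      |((G (f^[n + 1] j) : ℝ) - G (f^[n + 1] i)) - ρ * (G (f^[n] j) - G (f^[n] i))|
        ≤ ε * (G (f^[n] j) - G (f^[n] i))) : ρ = Real.exp a := by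
  set s : ℕ → ℕ := fun n => f^[n] (N₀ + 1) - f^[n] N₀ with hsdef
  have hs : ∀ n, f^[n] N₀ + s n = f^[n] (N₀ + 1) := fun n => by
    have := (hf.toIsCut.iterate n).lt_succ N₀
    simp only [hsdef]; omega
  have hspos : ∀ n, 0 < s n := fun n => by
    have := (hf.toIsCut.iterate n).lt_succ N₀
    simp only [hsdef]; omega
  have hsreal : ∀ n, (s n : ℝ) = (f^[n] (N₀ + 1) : ℝ) - f^[n] N₀ := fun n => by
    rw [← hs n]; push_cast; ring
  have hratio : Tendsto (fun n => (s (n + 1) : ℝ) / s n) atTop (nhds ρ) := by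
    rw [Metric.tendsto_atTop]
    intro ε hε
    obtain ⟨n₀, hn₀⟩ := h (ε / 2) (by positivity)
    refine ⟨n₀, fun n hn => ?_⟩
    have h1 := hn₀ n hn id (IsCut.id x) N₀ (N₀ + 1) le_rfl (Nat.le_succ _)
    simp only [id] at h1
    rw [← hsreal, ← hsreal] at h1
    have h2 : (0 : ℝ) < s n := by exact_mod_cast hspos n
    rw [Real.dist_eq, show (s (n + 1) : ℝ) / s n - ρ = (s (n + 1) - ρ * s n) / s n by field_simp,
      abs_div, abs_of_pos h2]
    refine lt_of_le_of_lt ?_ (half_lt_self hε)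
    rwa [div_le_iff₀ h2]
  have hge : 1 ≤ ρ := by
    refine ge_of_tendsto hratio (Eventually.of_forall fun n => ?_)
    have h2 : (0 : ℝ) < s n := by exact_mod_cast hspos n
    rw [le_div_iff₀ h2, one_mul]
    have h3 := hf.toIsCut.add_le (f^[n] N₀) (s n)
    rw [hs, ← Function.iterate_succ_apply' f n N₀, ← Function.iterate_succ_apply' f n (N₀ + 1),
      Nat.succ_eq_add_one, ← hs (n + 1)] at h3
    exact_mod_cast (by omega : s n ≤ s (n + 1))
  have hlog := tendsto_log_div_of_ratio (s := fun n => (s n : ℝ))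
    (fun n => by exact_mod_cast hspos n) (by linarith) hratio
  have hle : Real.log ρ ≤ a := by
    refine le_of_tendsto_of_tendsto' hlog (hf.tendsto_log ha (u := fun n => f^[n] (N₀ + 1))
      (P := N₀ + 1) (fun n => (hf.toIsCut.iterate n).mono (by omega)) fun n => le_rfl) fun n => ?_
    have h1 := hspos n
    have h2 := hs n
    have h3 : (s n : ℝ) ≤ f^[n] (N₀ + 1) := by exact_mod_cast (by omega : s n ≤ f^[n] (N₀ + 1))
    gcongr
  -- The initial part outside `B` cannot grow faster: `f^[n] N₀` is at most a constant times one
  -- block of the tail.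
  have hge' : a ≤ Real.log ρ := by
    obtain ⟨M, hM1, hM⟩ := hf.toIsCut.exists_bound
    have hC : ∀ n, f^[n] 1 ≤ f N₀ * M * s n := by
      intro n
      have h1 := hf.iterate_le_mul hN₀ n
      have h2 := leafMax_le_mul_block (h := fun _ => f) (fun _ => hf) hM1 (fun _ => hM)
        (List.replicate n true) (hN₀ N₀ le_rfl)
      rw [cutWord_replicate, ← hs, mul_add] at h2
      calc f^[n] 1 ≤ f^[n] N₀ := (hf.toIsCut.iterate n).mono hN₁
        _ ≤ f N₀ * leafMax x B f^[n] := h1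
        _ ≤ f N₀ * (M * s n) := Nat.mul_le_mul_left _ (by omega)
        _ = _ := by ring
    have hC0 : 0 < f N₀ * M := Nat.mul_pos (hN₁.trans (hf.le_apply N₀)) hM1
    have h3 : Tendsto (fun n : ℕ => Real.log ((f N₀ * M : ℕ) : ℝ) / n + Real.log (s n) / n) atTop
        (nhds (0 + Real.log ρ)) := (tendsto_const_div_atTop_nhds_zero_nat _).add hlog
    rw [zero_add] at h3
    refine le_of_tendsto_of_tendsto' ha h3 fun n => ?_
    have h4 : (0 : ℝ) < s n := by exact_mod_cast hspos n
    have h5 : (0 : ℝ) < ((f N₀ * M : ℕ) : ℝ) := by exact_mod_cast hC0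
    have h6 : (0 : ℝ) < f^[n] 1 := by
      exact_mod_cast lt_of_lt_of_le (Nat.two_pow_pos n) (hf.iterate_one_ge n)
    rw [← add_div, ← Real.log_mul h5.ne' h4.ne']
    have h7 : ((f^[n] 1 : ℕ) : ℝ) ≤ ((f N₀ * M : ℕ) : ℝ) * s n := by exact_mod_cast hC n
    gcongr
  rw [← le_antisymm hle hge', Real.exp_log (by linarith)]

end Rate

/-! ### Distances under two independent growth rates. -/

section Independent

theorem tendsto_iterated_ratio {T : ℕ × ℕ → ℝ} (hT : ∀ p, 0 < T p) {φ : ℕ × ℕ → ℕ × ℕ} {ρ : ℝ}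
    (hφ : Tendsto φ atTop atTop) (h : Tendsto (fun p => T (φ p) / T p) atTop (nhds ρ)) (k : ℕ) :
    Tendsto (fun p => T (φ^[k] p) / T p) atTop (nhds (ρ ^ k)) := by
  have hφk : ∀ k, Tendsto φ^[k] atTop atTop := by
    intro k
    induction k with
    | zero => exact tendsto_id
    | succ k ih => rw [Function.iterate_succ']; exact hφ.comp ih
  induction k with
  | zero => simp [div_self (hT _).ne']
  | succ k ih =>
    rw [pow_succ]
    refine (ih.mul (h.comp (hφk k))).congr fun p => ?_
    have h1 := (hT (φ^[k] p)).ne'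
    have h2 := (hT p).ne'
    simp only [Function.comp_apply, Function.iterate_succ_apply']
    field_simp

variable {A : Type*} {x : ℕ → A}

/-- If `x` is eventually a sequence over an alphabet of words of length two on which both cuts are
positive, and the growth exponents are rationally independent, then `x` is ultimately periodic. -/
theorem isUltimatelyPeriodic_of_eventually_mem [Finite A] {B : Set (A × A)} {N₀ : ℕ}
    {h : Bool → ℕ → ℕ} (hcut : ∀ b, IsCut x (h b)) (hh : ∀ b, IsLeafCut (pairSeq x) B (h b))
    (hN₀ : ∀ k, N₀ ≤ k → pairSeq x k ∈ B) {a : Bool → ℝ}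
    (ha : ∀ b, HasGrowthExponent (h b) (a b))
    (hind : ∀ k l : ℕ, 0 < k → 0 < l → k * a true ≠ l * a false) :
    IsUltimatelyPeriodic x := by
  classical
  by_contra hx
  wlog hN₁ : 1 ≤ N₀ generalizing N₀
  · exact this (N₀ := N₀ + 1) (fun k hk => hN₀ k (by omega)) (by omega)
  have := Fintype.ofFinite B
  set f := h true with hfdef
  set g := h false with hgdef
  have hf : IsLeafCut (pairSeq x) B f := hh true
  have hg : IsLeafCut (pairSeq x) B g := hh false
  obtain ⟨i, j, hi, hij, hpair⟩ : ∃ i j, N₀ + f N₀ ≤ i ∧ i < j ∧ pairSeq x i = pairSeq x j := by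
    obtain ⟨i, j, hne, heq⟩ := Finite.exists_ne_map_eq_of_infinite
      fun n => pairSeq x (N₀ + f N₀ + n)
    rcases lt_or_gt_of_ne hne with h | h
    · exact ⟨_, _, by omega, Nat.add_lt_add_left h _, heq⟩
    · exact ⟨_, _, by omega, Nat.add_lt_add_left h _, heq.symm⟩
  obtain ⟨M, hM1, hM⟩ := exists_common_bound hh
  -- The window has ratio `M` because one application of `f` multiplies a distance by at most `M`,
  -- so no sequence `n ↦ T (n, m)` can jump over it.
  obtain ⟨N, Θ₀, hN⟩ := exists_distances_eq hx hcut hh hN₀ hi hij hpair M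
  set T : ℕ × ℕ → ℕ := fun p => f^[p.1] (g^[p.2] j) - f^[p.1] (g^[p.2] i) with hTdef
  have hfn : ∀ n, IsCut (pairSeq x) f^[n] := hf.toIsCut.iterate
  have hgn : ∀ n, IsCut (pairSeq x) g^[n] := hg.toIsCut.iterate
  have hT : ∀ n m, f^[n] (g^[m] i) + T (n, m) = f^[n] (g^[m] j) := fun n m => by
    have := (hfn n).mono ((hgn m).mono hij.le)
    simp only [hTdef]; omega
  have hTpos : ∀ p, 0 < T p := fun p => by
    have := (hfn p.1).strictMono ((hgn p.2).strictMono hij)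
    simp only [hTdef]; omega
  have hTreal : ∀ n m, (T (n, m) : ℝ) = (f^[n] (g^[m] j) : ℝ) - f^[n] (g^[m] i) := fun n m => by
    rw [← hT n m]; push_cast; ring
  have hTpos' : ∀ p, (0 : ℝ) < T p := fun p => by exact_mod_cast hTpos p
  -- the growth rates
  obtain ⟨ρ, hρ⟩ := exists_growth_rate hf hN₀
  obtain ⟨θ, hθ⟩ := exists_growth_rate hg hN₀
  have hρa : ρ = Real.exp (a true) := growth_rate_eq_exp hf hN₀ hN₁ (ha true) hρ
  have hθa : θ = Real.exp (a false) := growth_rate_eq_exp hg hN₀ hN₁ (ha false) hθ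
  have ha0 : ∀ b, 0 < a b := fun b => (hh b).growth_pos (ha b)
  have hclose : ∀ {u v r ε : ℝ}, 0 < v → 0 < ε → |u - r * v| ≤ ε / 2 * v → |u / v - r| < ε := by
    intro u v r ε hv hε h
    rw [show u / v - r = (u - r * v) / v by field_simp, abs_div, abs_of_pos hv]
    refine lt_of_le_of_lt ?_ (half_lt_self hε)
    rwa [div_le_iff₀ hv]
  -- The limit is joint in both indices: the rate for `f` is uniform over the starting words, hence
  -- over `m`. The rate for `g` is uniform over the outer cut `f^[n]`.
  have hlim1 : Tendsto (fun p : ℕ × ℕ => (T (p.1 + 1, p.2) : ℝ) / T p) atTop (nhds ρ) := by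
    rw [Metric.tendsto_atTop]
    intro ε hε
    obtain ⟨n₀, hn₀⟩ := hρ (ε / 2) (by positivity)
    refine ⟨(n₀, 0), fun p hp => ?_⟩
    have h1 := hn₀ p.1 hp.1 id (IsCut.id _) (g^[p.2] i) (g^[p.2] j)
      (by have := (hgn p.2).le_apply i; omega) ((hgn p.2).mono hij.le)
    simp only [id] at h1
    rw [← hTreal, ← hTreal] at h1
    exact hclose (hTpos' p) hε h1
  have hlim2 : Tendsto (fun p : ℕ × ℕ => (T (p.1, p.2 + 1) : ℝ) / T p) atTop (nhds θ) := by
    rw [Metric.tendsto_atTop]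
    intro ε hε
    obtain ⟨n₀, hn₀⟩ := hθ (ε / 2) (by positivity)
    refine ⟨(0, n₀), fun p hp => ?_⟩
    have h1 := hn₀ p.2 hp.2 f^[p.1] (hfn p.1) i j (by omega) hij.le
    rw [← hTreal, ← hTreal] at h1
    exact hclose (hTpos' p) hε h1
  have hφ1 : Tendsto (fun p : ℕ × ℕ => (p.1 + 1, p.2)) atTop atTop := by
    rw [← prod_atTop_atTop_eq]
    exact Tendsto.prodMap (tendsto_add_atTop_nat 1) tendsto_id
  have hφ2 : Tendsto (fun p : ℕ × ℕ => (p.1, p.2 + 1)) atTop atTop := by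
    rw [← prod_atTop_atTop_eq]
    exact Tendsto.prodMap tendsto_id (tendsto_add_atTop_nat 1)
  have hit1 : ∀ k n m, (fun p : ℕ × ℕ => (p.1 + 1, p.2))^[k] (n, m) = (n + k, m) := by
    intro k n m
    induction k with
    | zero => rfl
    | succ k ih => rw [Function.iterate_succ_apply', ih]; rfl
  have hit2 : ∀ k n m, (fun p : ℕ × ℕ => (p.1, p.2 + 1))^[k] (n, m) = (n, m + k) := by
    intro k n m
    induction k with
    | zero => rfl
    | succ k ih => rw [Function.iterate_succ_apply', ih]; rfl
  have hpow : ∀ k l : ℕ, 1 ≤ l → ρ ^ k ≠ θ ^ l := by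
    intro k l hl heq
    rw [hρa, hθa, ← Real.exp_nat_mul, ← Real.exp_nat_mul, Real.exp_eq_exp] at heq
    rcases Nat.eq_zero_or_pos k with rfl | hk
    · have h1 := ha0 false
      have h2 : (0 : ℝ) < l := by exact_mod_cast hl
      have := mul_pos h2 h1
      simp at heq
      rcases heq with h | h
      · omega
      · linarith
    · exact hind k l hk (by omega) heq
  have hne : ∀ k l : ℕ, 1 ≤ l → ∀ᶠ p : ℕ × ℕ in atTop, T (p.1 + k, p.2) ≠ T (p.1, p.2 + l) := by
    intro k l hl
    have h1 := tendsto_iterated_ratio (T := fun p => (T p : ℝ)) hTpos' hφ1 hlim1 k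
    have h2 := tendsto_iterated_ratio (T := fun p => (T p : ℝ)) hTpos' hφ2 hlim2 l
    have h3 := (h1.sub h2).eventually_ne (sub_ne_zero.2 (hpow k l hl))
    filter_upwards [h3] with p hp heq
    apply hp
    simp only [hit1 k p.1 p.2, hit2 l p.1 p.2, heq, sub_self]
  -- eventual comparison of neighbours
  obtain ⟨c, hc⟩ : ∃ c : ℕ, θ < 2 ^ c := pow_unbounded_of_one_lt θ one_lt_two
  have hθ1 : 1 < θ := by rw [hθa]; exact Real.one_lt_exp_iff.2 (ha0 false)
  have hnb : ∀ᶠ p : ℕ × ℕ in atTop, T p ≤ T (p.1, p.2 + 1) ∧ T (p.1, p.2 + 1) ≤ 2 ^ c * T p := by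
    filter_upwards [hlim2.eventually_lt_const hc, hlim2.eventually_const_lt hθ1] with p h1 h2
    rw [div_lt_iff₀ (hTpos' p)] at h1
    rw [lt_div_iff₀ (hTpos' p), one_mul] at h2
    constructor
    · exact_mod_cast h2.le
    · exact_mod_cast h1.le
  have hall : ∀ᶠ p : ℕ × ℕ in atTop, (T p ≤ T (p.1, p.2 + 1) ∧ T (p.1, p.2 + 1) ≤ 2 ^ c * T p) ∧
      ∀ k ∈ Finset.range (c * N + 1), ∀ l ∈ Finset.Icc 1 N,
        T (p.1 + k, p.2) ≠ T (p.1, p.2 + l) := by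
    refine hnb.and ?_
    rw [Filter.eventually_all_finset]
    intro k _
    rw [Filter.eventually_all_finset]
    intro l hl
    exact hne k l (Finset.mem_Icc.1 hl).1
  obtain ⟨⟨n₁, m₁⟩, hK⟩ := eventually_atTop.1 hall
  replace hK : ∀ n m, n₁ ≤ n → m₁ ≤ m → _ := fun n m hn hm => hK (n, m) ⟨hn, hm⟩
  have hinc : ∀ n m l, n₁ ≤ n → m₁ ≤ m →
      T (n, m) ≤ T (n, m + l) ∧ T (n, m + l) ≤ 2 ^ (c * l) * T (n, m) := by
    intro n m l hn hm
    induction l with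
    | zero => simp
    | succ l ih =>
      obtain ⟨⟨h1, h2⟩, -⟩ := hK n (m + l) hn (by omega)
      refine ⟨ih.1.trans h1, h2.trans ?_⟩
      calc 2 ^ c * T (n, m + l) ≤ 2 ^ c * (2 ^ (c * l) * T (n, m)) := Nat.mul_le_mul_left _ ih.2
        _ = _ := by rw [← mul_assoc, ← pow_add]; congr 2; ring
  have hdouble : ∀ n m k, 2 ^ k * T (n, m) ≤ T (n + k, m) := by
    intro n m k
    induction k with
    | zero => simp
    | succ k ih =>
      have h1 := IsCut.mul_le_sub (G := f) (fun q _ _ => hf.two_le q)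
        ((hfn (n + k)).mono ((hgn m).mono hij.le))
      rw [← Function.iterate_succ_apply' f, ← Function.iterate_succ_apply' f] at h1
      have h2 := hT (n + k + 1) m
      have h3 := hT (n + k) m
      simp only [Nat.succ_eq_add_one] at h1
      rw [show f^[n + k] (g^[m] j) - f^[n + k] (g^[m] i) = T (n + k, m) by omega] at h1
      rw [pow_succ, show n + (k + 1) = n + k + 1 by rfl]
      linarith
  have hstep : ∀ n m, T (n + 1, m) ≤ M * T (n, m) := by
    intro n m
    have h1 := IsCut.sub_le_mul (G := f) (fun q _ _ => hM true q)
      ((hfn n).mono ((hgn m).mono hij.le))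
    rw [← Function.iterate_succ_apply' f, ← Function.iterate_succ_apply' f] at h1
    have h2 := hT (n + 1) m
    have h3 := hT n m
    simp only [Nat.succ_eq_add_one] at h1
    rw [show f^[n] (g^[m] j) - f^[n] (g^[m] i) = T (n, m) by omega] at h1
    linarith
  -- for each `m`, the first `n` at which the distance reaches the window
  set Θ := Θ₀ + 1 + ∑ l ∈ Finset.range (N + 1), T (n₁, m₁ + l) with hΘ
  have hfirst : ∀ l, l < N + 1 → ∃ n, n₁ ≤ n ∧ Θ ≤ T (n, m₁ + l) ∧ T (n, m₁ + l) < M * Θ ∧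
      ∀ n', n₁ ≤ n' → n' < n → T (n', m₁ + l) < Θ := by
    intro l hl
    have hex : ∃ d, Θ ≤ T (n₁ + d, m₁ + l) := by
      refine ⟨Θ, ?_⟩
      have h1 := hdouble n₁ (m₁ + l) Θ
      have h2 := Nat.lt_two_pow_self (n := Θ)
      have h3 := hTpos (n₁, m₁ + l)
      nlinarith
    have hlt : ∀ d, d < Nat.find hex → T (n₁ + d, m₁ + l) < Θ := fun d hd =>
      not_le.1 (Nat.find_min hex hd)
    refine ⟨n₁ + Nat.find hex, by omega, Nat.find_spec hex, ?_, fun n' h1 h2 => ?_⟩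
    -- `Θ` exceeds every `T (n₁, m₁ + l)`, so the first time is not zero and the preceding distance
    -- is below `Θ`.
    · rcases h0 : Nat.find hex with _ | d
      · exfalso
        have h1 := Nat.find_spec hex
        rw [h0, add_zero] at h1
        have h2 := Finset.single_le_sum (f := fun l => T (n₁, m₁ + l)) (fun _ _ => Nat.zero_le _)
          (Finset.mem_range.2 hl)
        omega
      · have h1 := hlt d (by omega)
        exact (hstep (n₁ + d) (m₁ + l)).trans_lt (Nat.mul_lt_mul_of_pos_left h1 hM1)
    · have := hlt (n' - n₁) (by omega)
      rwa [show n₁ + (n' - n₁) = n' by omega] at this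
  choose! n hn1 hn2 hn3 hn4 using hfirst
  set W : ℕ → List Bool := fun l => List.replicate (n l) true ++ List.replicate (m₁ + l) false
    with hW
  have hWT : ∀ l z, cutWord h (W l) z = f^[n l] (g^[m₁ + l] z) := fun l z => by
    simp only [hW, cutWord_append, cutWord_replicate, Function.comp_apply, hfdef, hgdef]
  have hWinj : Function.Injective W := by
    intro l l' hl
    have := congrArg (List.count false) hl
    simp [hW, List.count_replicate] at this
    omega
  obtain ⟨w, hw, w', hw', hww, heq⟩ := hN Θ (by omega) ((Finset.range (N + 1)).image W) (by
      intro w hw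
      obtain ⟨l, hl, rfl⟩ := Finset.mem_image.1 hw
      rw [hWT, hWT]
      have h1 := hT (n l) (m₁ + l)
      have h2 := hn2 l (Finset.mem_range.1 hl)
      have h3 := hn3 l (Finset.mem_range.1 hl)
      constructor <;> omega)
    (by rw [Finset.card_image_of_injective _ hWinj]; simp)
  obtain ⟨l, hl, rfl⟩ := Finset.mem_image.1 hw
  obtain ⟨l', hl', rfl⟩ := Finset.mem_image.1 hw'
  -- Since `T` increases in `m`, first times do not increase with `l`. Equal distances would give `T
  -- (n + k, m) = T (n, m + d)` with `2 ^ k ≤ 2 ^ (c * d)`, so `k ≤ c * N`, one of the finitely many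
  -- coincidences already excluded.
  have key : ∀ l l', l < l' → l' < N + 1 → T (n l, m₁ + l) ≠ T (n l', m₁ + l') := by
    intro l l' hll hl' heq
    obtain ⟨d, rfl⟩ : ∃ d, l' = l + d := ⟨l' - l, by omega⟩
    have h1 := hn1 l (by omega)
    have h2 := hn1 (l + d) hl'
    have hle : n (l + d) ≤ n l := by
      by_contra hcon
      push Not at hcon
      have h3 := hn4 (l + d) hl' (n l) h1 hcon
      have h4 := hn2 l (by omega)
      have h5 := (hinc (n l) (m₁ + l) d h1 (by omega)).1
      rw [← add_assoc] at h3
      omega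
    obtain ⟨k, hk⟩ : ∃ k, n l = n (l + d) + k := ⟨n l - n (l + d), by omega⟩
    have h3 := hdouble (n (l + d)) (m₁ + l) k
    have h4 := (hinc (n (l + d)) (m₁ + l) d h2 (by omega)).2
    rw [hk, ← add_assoc] at heq
    have h5 : 2 ^ k ≤ 2 ^ (c * d) :=
      Nat.le_of_mul_le_mul_right (by omega) (hTpos (n (l + d), m₁ + l))
    have h6 : k ≤ c * d := (Nat.pow_le_pow_iff_right (by norm_num)).1 h5
    have h7 : c * d ≤ c * N := Nat.mul_le_mul_left _ (by omega)
    exact (hK (n (l + d)) (m₁ + l) h2 (by omega)).2 k (Finset.mem_range.2 (by omega)) d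
      (Finset.mem_Icc.2 (by omega)) heq
  have hll : l ≠ l' := fun h => hww (by rw [h])
  rw [Finset.mem_range] at hl hl'
  rw [hWT, hWT, hWT, hWT] at heq
  have e1 := hT (n l) (m₁ + l)
  have e2 := hT (n l') (m₁ + l')
  have e3 : T (n l, m₁ + l) = T (n l', m₁ + l') := by omega
  rcases lt_or_gt_of_ne hll with h | h
  · exact key l l' h hl' e3
  · exact key l' l h hl e3.symm

/-- Two growing cuts of `x` with rationally independent growth exponents force `x` to be ultimately
periodic. -/
theorem isUltimatelyPeriodic_of_cuts [Finite A] {f : Bool → ℕ → ℕ} (hf : ∀ b, IsCut x (f b))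
    (hgrow : ∀ b i, ∃ n, ∀ m, n ≤ m → (f b)^[m] i + 2 ≤ (f b)^[m] (i + 1)) {a : Bool → ℝ}
    (ha : ∀ b, HasGrowthExponent (f b) (a b))
    (hind : ∀ k l : ℕ, 0 < k → 0 < l → k * a true ≠ l * a false) :
    IsUltimatelyPeriodic x := by
  have hpair : ∀ b, IsCut (pairSeq x) (f b) := fun b => (hf b).pair
  choose p hp1 hp using fun b => exists_isIdemCut_iterate (hpair b) (hgrow b)
  -- `B` is chosen from the sequence alone, so it serves both cuts.
  obtain ⟨B, hB⟩ := exists_minimal_unboundedAlphabet (pairSeq x)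
  have hleaf : ∀ b, IsLeafCut (pairSeq x) B ((f b)^[p b])^[2] := fun b => (hp b).isLeafCut hB
  have ha' : ∀ b, HasGrowthExponent ((f b)^[p b])^[2] ((2 : ℕ) * (p b * a b)) := fun b =>
    ((ha b).iterate (hp1 b)).iterate (by norm_num)
  have hind' : ∀ k l : ℕ, 0 < k → 0 < l →
      k * ((2 : ℕ) * (p true * a true)) ≠ l * ((2 : ℕ) * (p false * a false)) := by
    intro k l hk hl heq
    refine hind (k * p true) (l * p false) (Nat.mul_pos hk (hp1 _)) (Nat.mul_pos hl (hp1 _)) ?_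
    push_cast at heq ⊢
    linarith
  obtain ⟨N₀, hN₀⟩ := eventually_mem_leaf (h := fun b => ((f b)^[p b])^[2])
    (a := fun b => (2 : ℕ) * (p b * a b)) hleaf hB.1 ha' hind'
  exact isUltimatelyPeriodic_of_eventually_mem (h := fun b => ((f b)^[p b])^[2])
    (a := fun b => (2 : ℕ) * (p b * a b)) (fun b => ((hf b).iterate (p b)).iterate 2) hleaf hN₀
    ha' hind'

end Independent

/-! ### From substitutions to cuts. -/

section Morphism

variable {A : Type*}

theorem morphWord_append {B : Type*} (τ : A → List B) (v w : List A) :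
    morphWord τ (v ++ w) = morphWord τ v ++ morphWord τ w := List.flatMap_append

theorem morphWord_iterate_append (τ : A → List A) (n : ℕ) (v w : List A) :
    (morphWord τ)^[n] (v ++ w) = (morphWord τ)^[n] v ++ (morphWord τ)^[n] w := by
  induction n generalizing v w with
  | zero => rfl
  | succ n ih => simp only [Function.iterate_succ_apply, morphWord_append, ih]

theorem seqPrefix_succ (x : ℕ → A) (n : ℕ) : seqPrefix x (n + 1) = seqPrefix x n ++ [x n] := by
  simp [seqPrefix, List.range_succ]

theorem length_seqPrefix (x : ℕ → A) (n : ℕ) : (seqPrefix x n).length = n := by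
  simp [seqPrefix]

namespace WordSubstitution

variable {σ : WordSubstitution A} {x : ℕ → A}

/-- The lengths of the images of the prefixes of `x`. -/
def prefixLength (σ : WordSubstitution A) (x : ℕ → A) (n : ℕ) : ℕ :=
  (morphWord σ.toFun (seqPrefix x n)).length

/-- Images of prefixes are prefixes of one another, so the letter of index `k` may be read off the
image of any prefix that is long enough. -/
theorem IsFixedPt.morphWord_seqPrefix (h : σ.IsFixedPt x) (n : ℕ) :
    morphWord σ.toFun (seqPrefix x n) = seqPrefix x (σ.prefixLength x n) := by
  have hstep : ∀ n d k, k < (morphWord σ.toFun (seqPrefix x n)).length →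
      (morphWord σ.toFun (seqPrefix x (n + d)))[k]? =
        (morphWord σ.toFun (seqPrefix x n))[k]? := by
    intro n d k hk
    induction d with
    | zero => rfl
    | succ d ih =>
      rw [← add_assoc, seqPrefix_succ, morphWord_append, List.getElem?_append_left, ih]
      by_contra hcon
      rw [List.getElem?_eq_none (not_lt.1 hcon), eq_comm, List.getElem?_eq_none_iff] at ih
      omega
  have hlast : ∀ k, (morphWord σ.toFun (seqPrefix x (k + 1)))[k]? = some (x k) := by
    intro k
    have h1 := congrFun h k
    rw [← h1]
    exact List.getElem?_eq_getElem _
  refine List.ext_getElem? fun k => ?_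
  by_cases hk : k < σ.prefixLength x n
  · have h1 : (seqPrefix x (σ.prefixLength x n))[k]? = some (x k) := by
      simp [seqPrefix, hk]
    rw [h1, ← hlast k]
    have hk' : k < (morphWord σ.toFun (seqPrefix x (k + 1))).length := by
      have := σ.length_le_length_morphWord (seqPrefix x (k + 1))
      rw [length_seqPrefix] at this
      omega
    rw [← hstep n (k + 1) k hk, ← hstep (k + 1) n k hk', add_comm n]
  · rw [List.getElem?_eq_none (not_lt.1 hk),
      List.getElem?_eq_none (by rw [length_seqPrefix]; exact not_lt.1 hk)]

theorem IsFixedPt.iterate_seqPrefix (h : σ.IsFixedPt x) (m n : ℕ) :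
    (morphWord σ.toFun)^[m] (seqPrefix x n) = seqPrefix x ((σ.prefixLength x)^[m] n) := by
  induction m with
  | zero => rfl
  | succ m ih =>
    rw [Function.iterate_succ_apply', Function.iterate_succ_apply', ih, h.morphWord_seqPrefix]

theorem IsFixedPt.iterate_prefixLength_succ (h : σ.IsFixedPt x) (m i : ℕ) :
    (σ.prefixLength x)^[m] (i + 1) =
      (σ.prefixLength x)^[m] i + ((morphWord σ.toFun)^[m] [x i]).length := by
  have h1 := congrArg List.length (h.iterate_seqPrefix m (i + 1))
  rw [seqPrefix_succ, morphWord_iterate_append, List.length_append, h.iterate_seqPrefix,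
    length_seqPrefix, length_seqPrefix] at h1
  exact h1.symm

theorem IsFixedPt.isCut (h : σ.IsFixedPt x) : IsCut x (σ.prefixLength x) := by
  have hsucc : ∀ i, σ.prefixLength x (i + 1) = σ.prefixLength x i + (σ.toFun (x i)).length := by
    intro i
    simp [prefixLength, seqPrefix_succ, morphWord]
  have hget : ∀ i s, σ.prefixLength x i + s < σ.prefixLength x (i + 1) →
      (σ.toFun (x i))[s]? = some (x (σ.prefixLength x i + s)) := by
    intro i s hs
    have h1 := h.morphWord_seqPrefix (i + 1)
    rw [seqPrefix_succ, morphWord_append, h.morphWord_seqPrefix] at h1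
    have h2 := congrArg (fun l => l[σ.prefixLength x i + s]?) h1
    change (_ ++ _)[_]? = (seqPrefix x _)[_]? at h2
    rw [List.getElem?_append_right (by rw [length_seqPrefix]; omega), length_seqPrefix,
      add_tsub_cancel_left] at h2
    simpa [morphWord, seqPrefix, hs] using h2
  refine ⟨rfl, fun i => ?_, fun i j hij => ?_, fun i j hij s hs => ?_⟩
  · have := List.length_pos_iff.2 (σ.toFun_ne_nil (x i))
    rw [hsucc]; omega
  · rw [hsucc, hsucc, hij]; ring
  · have h1 := hget i s hs
    have h2 := hget j s (by rw [hsucc] at hs ⊢; rw [← hij]; omega)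
    rw [hij, h2] at h1
    exact (Option.some.inj h1).symm

theorem IsFixedPt.growing (h : σ.IsFixedPt x) (i : ℕ) : ∃ n, ∀ m, n ≤ m →
    (σ.prefixLength x)^[m] i + 2 ≤ (σ.prefixLength x)^[m] (i + 1) := by
  obtain ⟨n, hn⟩ := eventually_atTop.1 ((σ.tendsto_length (x i)).eventually_ge_atTop 2)
  refine ⟨n, fun m hm => ?_⟩
  have := hn m hm
  rw [h.iterate_prefixLength_succ]
  omega

end WordSubstitution

variable [Fintype A] [DecidableEq A]

theorem count_morphWord (τ : A → List A) (w : List A) (i : A) :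
    (morphWord τ w).count i = ∑ j, morphMatrix τ i j * w.count j := by
  induction w with
  | nil => simp [morphWord]
  | cons a w ih =>
    have h1 : morphWord τ (a :: w) = τ a ++ morphWord τ w := by simp [morphWord]
    rw [h1, List.count_append, ih]
    simp only [List.count_cons, mul_add, Finset.sum_add_distrib]
    rw [add_comm]
    congr 1
    simp [morphMatrix]

theorem count_morphWord_iterate (τ : A → List A) (n : ℕ) (i j : A) :
    ((morphWord τ)^[n] [j]).count i = (morphMatrix τ ^ n) i j := by
  induction n generalizing i with
  | zero =>
    rw [Function.iterate_zero, id, pow_zero, Matrix.one_apply, List.count_singleton]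
    simp only [beq_iff_eq]
    exact if_congr eq_comm rfl rfl
  | succ n ih =>
    rw [Function.iterate_succ_apply', count_morphWord, pow_succ', Matrix.mul_apply]
    simp only [ih]

theorem length_morphWord_iterate (τ : A → List A) (n : ℕ) (j : A) :
    ((morphWord τ)^[n] [j]).length = ∑ i, (morphMatrix τ ^ n) i j := by
  simp only [← count_morphWord_iterate]
  have h := Multiset.sum_count_eq_card (s := Finset.univ)
    (m := (((morphWord τ)^[n] [j] : List A) : Multiset A)) fun _ _ => Finset.mem_univ _
  simpa only [Multiset.coe_count, Multiset.coe_card] using h.symm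

end Morphism

/-! ### Dominant eigenvalues as growth exponents, and the conclusion. -/

section Gelfand

variable {A : Type*} [Fintype A] [DecidableEq A]

attribute [local instance] Matrix.linftyOpNormedRing Matrix.linftyOpNormedAlgebra

/-- Gelfand's formula for the dominant eigenvalue. -/
theorem IsDominantEigenvalue.tendsto_norm_pow {M : Matrix A A ℕ} {r : ℝ}
    (h : IsDominantEigenvalue M r) : 0 ≤ r ∧
    Tendsto (fun n : ℕ => ‖(M.map (Nat.cast : ℕ → ℂ)) ^ n‖ ^ (1 / n : ℝ)) atTop (nhds r) := by
  set M' := M.map (Nat.cast : ℕ → ℂ)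
  obtain ⟨h1, h2⟩ := h
  have hr : 0 ≤ r := (norm_nonneg _).trans (h2 _ h1)
  have hspec : ∀ μ : ℂ, Module.End.HasEigenvalue (Matrix.toLin' M') μ ↔ μ ∈ spectrum ℂ M' :=
    fun μ => by rw [Module.End.hasEigenvalue_iff_mem_spectrum, Matrix.spectrum_toLin']
  have hrad : spectralRadius ℂ M' = ENNReal.ofReal r := by
    refine le_antisymm (iSup₂_le fun μ hμ => ?_) ?_
    · have := h2 μ ((hspec μ).2 hμ)
      rw [← enorm_eq_nnnorm, ← ofReal_norm]
      exact ENNReal.ofReal_le_ofReal this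
    · have h3 := le_iSup₂ (f := fun (k : ℂ) (_ : k ∈ spectrum ℂ M') => (‖k‖₊ : ENNReal)) (r : ℂ)
        ((hspec r).1 h1)
      refine le_trans (le_of_eq ?_) h3
      rw [← enorm_eq_nnnorm, ← ofReal_norm, Complex.norm_real, Real.norm_of_nonneg hr]
  have h4 := spectrum.pow_norm_pow_one_div_tendsto_nhds_spectralRadius M'
  rw [hrad] at h4
  refine ⟨hr, ?_⟩
  have h5 := (ENNReal.tendsto_toReal ENNReal.ofReal_ne_top).comp h4
  rw [ENNReal.toReal_ofReal hr] at h5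
  refine h5.congr fun n => ?_
  simp only [Function.comp_apply]
  rw [ENNReal.toReal_ofReal (by positivity)]

theorem norm_map_natCast_le (N : Matrix A A ℕ) :
    ‖N.map (Nat.cast : ℕ → ℂ)‖ ≤ ∑ i, ∑ j, (N i j : ℝ) := by
  have h : ‖N.map (Nat.cast : ℕ → ℂ)‖₊ ≤ ∑ i, ∑ j, (N i j : NNReal) := by
    rw [Matrix.linfty_opNNNorm_def]
    refine Finset.sup_le fun i _ => ?_
    refine le_trans (le_of_eq ?_) (Finset.single_le_sum (f := fun i => ∑ j, (N i j : NNReal))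
      (fun _ _ => zero_le) (Finset.mem_univ i))
    exact Finset.sum_congr rfl fun j _ => by simp
  exact_mod_cast h

theorem natCast_le_norm_map (N : Matrix A A ℕ) (i j : A) :
    (N i j : ℝ) ≤ ‖N.map (Nat.cast : ℕ → ℂ)‖ := by
  have h : (N i j : NNReal) ≤ ‖N.map (Nat.cast : ℕ → ℂ)‖₊ := by
    rw [Matrix.linfty_opNNNorm_def]
    refine le_trans ?_ (Finset.le_sup (f := fun i => ∑ j, ‖N.map (Nat.cast : ℕ → ℂ) i j‖₊)
      (Finset.mem_univ i))
    refine le_trans (le_of_eq ?_) (Finset.single_le_sum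
      (f := fun j => ‖N.map (Nat.cast : ℕ → ℂ) i j‖₊) (fun _ _ => zero_le)
      (Finset.mem_univ j))
    simp
  exact_mod_cast h

/-- The growth exponent of the lengths of the prefixes of a proper fixed point is the logarithm of
the dominant eigenvalue. -/
theorem WordSubstitution.IsProperFixedPt.hasGrowthExponent {σ : WordSubstitution A} {x : ℕ → A}
    {α : ℝ} (h : σ.IsProperFixedPt x) (hα : σ.HasDominantEigenvalue α) :
    0 < α ∧ HasGrowthExponent (σ.prefixLength x) (Real.log α) := by
  obtain ⟨hfix, hall⟩ := h
  set f := σ.prefixLength x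
  have hf : IsCut x f := hfix.isCut
  set M := morphMatrix σ.toFun
  set M' := M.map (Nat.cast : ℕ → ℂ)
  obtain ⟨hα0, hlim⟩ := IsDominantEigenvalue.tendsto_norm_pow hα
  change Tendsto (fun n : ℕ => ‖M' ^ n‖ ^ (1 / n : ℝ)) atTop (nhds α) at hlim
  have hpow : ∀ n, M' ^ n = (M ^ n).map (Nat.cast : ℕ → ℂ) := fun n => by
    have := map_pow (Nat.castRingHom ℂ).mapMatrix M n
    exact this.symm
  have hf1 : ∀ n, f^[n] 1 = ((morphWord σ.toFun)^[n] [x 0]).length := fun n => by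
    have h1 := hfix.iterate_prefixLength_succ n 0
    change f^[n] (0 + 1) = f^[n] 0 + _ at h1
    rw [(hf.iterate n).zero, zero_add, zero_add] at h1
    exact h1
  have hftop : Tendsto (fun n => f^[n] 1) atTop atTop :=
    (σ.tendsto_length (x 0)).congr fun n => (hf1 n).symm
  set k := Fintype.card A with hk
  have hk0 : 0 < k := Fintype.card_pos_iff.2 ⟨x 0⟩
  have hk0' : (0 : ℝ) < k := by exact_mod_cast hk0
  have hlow : ∀ n, (f^[n] 1 : ℝ) ≤ k * ‖M' ^ n‖ := by
    intro n
    rw [hf1, length_morphWord_iterate, hpow]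
    push_cast
    refine (Finset.sum_le_card_nsmul _ _ ‖(M ^ n).map (Nat.cast : ℕ → ℂ)‖ fun i _ =>
      natCast_le_norm_map (M ^ n) i (x 0)).trans ?_
    rw [nsmul_eq_mul]
    exact le_of_eq rfl
  -- Properness enters here: all letters occur in the prefix of some length `f^[r] 1`, so every
  -- column sum of `M ^ n` is at most `f^[n + r] 1 ≤ R ^ r * f^[n] 1`.
  obtain ⟨C, hC0, hC⟩ : ∃ C : ℕ, 0 < C ∧ ∀ n, ‖M' ^ n‖ ≤ C * (f^[n] 1 : ℝ) := by
    choose p hp using hall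
    obtain ⟨R, hR1, hR⟩ := hf.exists_bound
    obtain ⟨r, hr⟩ := (hftop.eventually_ge_atTop (∑ a, (p a + 1))).exists
    have hmul : ∀ r y, f^[r] y ≤ R ^ r * y := by
      intro r y
      induction r with
      | zero => simp
      | succ r ih =>
        have h1 := IsCut.sub_le_mul (G := f) (fun q _ _ => hR q) (Nat.zero_le (f^[r] y))
        rw [hf.zero, Nat.sub_zero, zero_add] at h1
        rw [Function.iterate_succ_apply', pow_succ]
        nlinarith
    refine ⟨k * R ^ r, Nat.mul_pos hk0 (Nat.pow_pos hR1), fun n => ?_⟩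
    have hlen : ∀ a, ∑ i, (M ^ n) i a ≤ R ^ r * f^[n] 1 := by
      intro a
      have h1 := hfix.iterate_prefixLength_succ n (p a)
      rw [hp a, length_morphWord_iterate] at h1
      have h2 : p a + 1 ≤ f^[r] 1 := (Finset.single_le_sum (f := fun a => p a + 1)
        (fun _ _ => Nat.zero_le _) (Finset.mem_univ a)).trans hr
      have h3 := (hf.iterate n).mono h2
      rw [← Function.iterate_add_apply, add_comm n r, Function.iterate_add_apply] at h3
      have h4 := hmul r (f^[n] 1)
      change f^[n] (p a + 1) = _ + ∑ i, (M ^ n) i a at h1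
      omega
    rw [hpow]
    refine (norm_map_natCast_le _).trans ?_
    rw [Finset.sum_comm]
    have h5 : ∑ a, ∑ i, (M ^ n) i a ≤ k * (R ^ r * f^[n] 1) := by
      refine (Finset.sum_le_card_nsmul _ _ _ fun a _ => hlen a).trans ?_
      rw [smul_eq_mul]
      exact le_of_eq rfl
    rw [← mul_assoc] at h5
    exact_mod_cast h5
  have hα1 : 1 ≤ α := by
    refine ge_of_tendsto hlim ?_
    filter_upwards [hftop.eventually_ge_atTop k] with n hn
    have h1 : (k : ℝ) * 1 ≤ k * ‖M' ^ n‖ := by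
      rw [mul_one]
      exact le_trans (by exact_mod_cast hn) (hlow n)
    exact Real.one_le_rpow (le_of_mul_le_mul_left h1 hk0') (by positivity)
  have hfpos : ∀ n, (0 : ℝ) < f^[n] 1 := fun n => by
    have := (hf.iterate n).le_apply 1
    exact_mod_cast this
  have hnpos : ∀ n, 0 < ‖M' ^ n‖ := fun n => by
    have := (hfpos n).trans_le (hlow n)
    exact pos_of_mul_pos_right this hk0'.le
  have hlog : Tendsto (fun n : ℕ => Real.log ‖M' ^ n‖ / n) atTop (nhds (Real.log α)) := by
    refine (hlim.log (by linarith)).congr fun n => ?_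
    rw [Real.log_rpow (hnpos n)]
    ring
  refine ⟨by linarith, ?_⟩
  have hC0' : (0 : ℝ) < C := by exact_mod_cast hC0
  have hupper := (tendsto_const_div_atTop_nhds_zero_nat (Real.log k)).add hlog
  have hlower := hlog.sub (tendsto_const_div_atTop_nhds_zero_nat (Real.log C))
  rw [zero_add] at hupper
  rw [sub_zero] at hlower
  refine tendsto_of_tendsto_of_tendsto_of_le_of_le hlower hupper (fun n => ?_) fun n => ?_
  · change Real.log ‖M' ^ n‖ / n - Real.log C / n ≤ Real.log (f^[n] 1) / n
    have h1 := Real.log_le_log (hnpos n) (hC n)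
    rw [Real.log_mul hC0'.ne' (hfpos n).ne'] at h1
    rw [← sub_div]
    gcongr
    linarith
  · change Real.log (f^[n] 1) / n ≤ Real.log k / n + Real.log ‖M' ^ n‖ / n
    have h1 := Real.log_le_log (hfpos n) (hlow n)
    rw [Real.log_mul hk0'.ne' (hnpos n).ne'] at h1
    rw [← add_div]
    gcongr

end Gelfand

theorem mainTheorem2 {A : Type*} [Fintype A] [DecidableEq A] (x : ℕ → A)
    (σ τ : WordSubstitution A) (α β : ℝ)
    (hσ : σ.IsProperFixedPt x) (hα : σ.HasDominantEigenvalue α)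
    (hτ : τ.IsProperFixedPt x) (hβ : τ.HasDominantEigenvalue β)
    (hαβ : MultIndependent α β) :
    IsUltimatelyPeriodic x := by
  obtain ⟨hα0, hσa⟩ := hσ.hasGrowthExponent hα
  obtain ⟨hβ0, hτb⟩ := hτ.hasGrowthExponent hβ
  refine isUltimatelyPeriodic_of_cuts
    (f := fun b => bif b then σ.prefixLength x else τ.prefixLength x)
    (a := fun b => bif b then Real.log α else Real.log β) ?_ ?_ ?_ fun k l hk hl heq => ?_
  · rintro (_ | _)
    exacts [hτ.1.isCut, hσ.1.isCut]
  · rintro (_ | _)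
    exacts [hτ.1.growing, hσ.1.growing]
  · rintro (_ | _)
    exacts [hτb, hσa]
  · simp only [cond_true, cond_false, ← Real.log_pow] at heq
    exact hαβ k l hk hl (Real.log_injOn_pos (Set.mem_Ioi.2 (by positivity))
      (Set.mem_Ioi.2 (by positivity)) heq)
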